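/- Let $f:\mathbb{C}\to\mathbb{C}P^2$ (Fubini--Study metric of holomorphic sectional curvature $4$) be a conformally parametrized minimal Lagrangian immersion that is translationally equivariant: there is a one-parameter subgroup $R(t)$ of $SU(3)$ with $f(t+z)=R(t)f(z)$ for all $t\in\mathbb{R}$, $z\in\mathbb{C}$. Let $F:\mathbb{C}\to S^5\subset\mathbb{C}^3$ be a horizontal lift of $f$, $2e^{u}\,dz\,d\bar z$ with $e^u=F_z\cdot\overline{F_z}$ the induced metric, and write the cubic Hopf differential as $(F_{zz}\cdot\overline{F_{\bar z}})\,dz^3=-i\lambda^{-3}\psi\,dz^3$ with $|\lambda|=1$. Assume that $f$ is neither totally geodesic nor flat, i.e. $\psi\not\equiv0$ and $u$ is not constant. (Then $\psi$ is constant and $u$ depends only on $y=\operatorname{Im} z$.) Let $D=\mathbb{F}^{-1}\partial_x\mathbb{F}|_{z=0}$, where $\mathbb{F}$ is the matrix with columns $-i\lambda e^{-u/2}F_z,\ (i\lambda)^{-1}e^{-u/2}F_{\bar z},\ F$, and let $id_1,id_2,id_3$ be the eigenvalues of $D$, in any order and with multiplicity. Put $a_1=\max e^{u}$, $\delta=|\psi|^2/(2a_1^2)$,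 $a_2=\tfrac12\bigl(\delta+\sqrt{\delta^2+4a_1\delta}\bigr)$, $a_3=\tfrac12\bigl(-\delta+\sqrt{\delta^2+4a_1\delta}\bigr)$, and $$T=\frac{1}{\sqrt{2(a_1+a_3)}}\int_0^{\pi/2}\frac{d\alpha}{\sqrt{1-k^2\sin^2\alpha}},\qquad k^2=\frac{a_1-a_2}{a_1+a_3}$$ (so $2T$ is the smallest positive period of $y\mapsto u(iy)$). Let $\mathcal{L}(f)=\{\omega\in\mathbb{C}: f(z+\omega)=f(z)\text{ for all }z\in\mathbb{C}\}$ be the period lattice, and call $f$ an equivariant torus if $\mathcal{L}(f)$ contains two elements that are linearly independent over $\mathbb{R}$. Suppose that $\lambda^{-3}\psi$ is real. (1) If $f$ is an equivariant torus, then $f$ has a smallest positive real period $p_f$, $$\mathcal{L}(f)=p_f\mathbb{Z}+4Ti\,\mathbb{Z}\quad\text{or}\quad \mathcal{L}(f)=p_f\mathbb{Z}+\bigl(\tfrac12p_f+2Ti\bigr)\mathbb{Z},$$ and in both cases $d_2\ne0$ and $d_1/d_2$ is rational. (2) Conversely, if $d_1/d_2$ is rational, then $f$ is an equivariant torus, and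 $\mathcal{L}(f)$ is one of the two lattices in (1), where $p_f$ is the smallest positive real period of $f$. -/

import Mathlib

namespace MinLag

open scoped ContDiff Matrix
open Complex

/-- The Hermitian space `ℂ³`; the product `Z · W̄ = ∑ k, Z k * conj (W k)` is `Z ⬝ᵥ star W`. -/
abbrev C3 : Type := Fin 3 → ℂ

/-- The complex projective plane. -/
abbrev CP2 : Type := Projectivization ℂ C3

noncomputable section

/-- `∂F/∂z = (F_x - i F_y) / 2`, where `z = x + i y`. -/
def dz (F : ℂ → C3) (z : ℂ) : C3 :=
  (1 / 2 : ℂ) • (fderiv ℝ F z 1 - I • fderiv ℝ F z I)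

/-- `∂F/∂z̄ = (F_x + i F_y) / 2`, where `z = x + i y`. -/
def dzbar (F : ℂ → C3) (z : ℂ) : C3 :=
  (1 / 2 : ℂ) • (fderiv ℝ F z 1 + I • fderiv ℝ F z I)

/-- The conformal factor `e^u = F_z · conj F_z`; the induced metric is `2 e^u dz dz̄`. -/
def expU (F : ℂ → C3) (z : ℂ) : ℝ := (dz F z ⬝ᵥ star (dz F z)).re

/-- The function `u` in the induced metric `2 e^u dz dz̄`. -/
def metricU (F : ℂ → C3) (z : ℂ) : ℝ := Real.log (expU F z)

/-- The coefficient `F_zz · conj F_z̄` of the cubic Hopf differential. -/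
def hopf (F : ℂ → C3) (z : ℂ) : ℂ := dz (dz F) z ⬝ᵥ star (dzbar F z)

/-- The horizontal lift along `F` of the mean curvature vector of the conformal immersion `[F]`
into the complex projective plane with the Fubini-Study metric of holomorphic sectional
curvature 4.  For a horizontal unit lift `F`, the Levi-Civita derivative `∇_z̄ (∂ f / ∂ z)`
lifts to the component of `F_zz̄` orthogonal to the complex line through `F`, and half the trace
of the second fundamental form with respect to `2 e^u dz dz̄` is `e^{-u} ∇_z̄ (∂ f / ∂ z)`. -/
def meanCurvature (F : ℂ → C3) (z : ℂ) : C3 :=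
  ((expU F z : ℂ)⁻¹) •
    (dzbar (dz F) z - (dzbar (dz F) z ⬝ᵥ star (F z)) • F z)

/-- `F : ℂ → S⁵` is a smooth horizontal lift of the conformally parametrized minimal Lagrangian
immersion `f : ℂ → ℂP²`. -/
structure IsMinimalLagrangianLift (F : ℂ → C3) (f : ℂ → CP2) : Prop where
  smooth : ContDiff ℝ ∞ F
  unit : ∀ z, F z ⬝ᵥ star (F z) = 1
  lift : ∀ z, ∃ h : F z ≠ 0, f z = Projectivization.mk ℂ (F z) h
  horizontal_dz : ∀ z, dz F z ⬝ᵥ star (F z) = 0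
  horizontal_dzbar : ∀ z, dzbar F z ⬝ᵥ star (F z) = 0
  immersion : ∀ z, 0 < expU F z
  conformal : ∀ z, dz F z ⬝ᵥ star (dzbar F z) = 0
  conformal_dz : ∀ z, dz F z ⬝ᵥ star (dz F z) = (expU F z : ℂ)
  conformal_dzbar : ∀ z, dzbar F z ⬝ᵥ star (dzbar F z) = (expU F z : ℂ)
  minimal : ∀ z, meanCurvature F z = 0

/-- A special unitary matrix acts injectively on `ℂ³`. -/
theorem toLin_injective (A : Matrix.specialUnitaryGroup (Fin 3) ℂ) :
    Function.Injective (Matrix.toLin' (A : Matrix (Fin 3) (Fin 3) ℂ)) := by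
  have hdet : (A : Matrix (Fin 3) (Fin 3) ℂ).det = 1 :=
    (Matrix.mem_specialUnitaryGroup_iff.mp A.2).2
  have h : Function.Injective (A : Matrix (Fin 3) (Fin 3) ℂ).mulVec :=
    Matrix.mulVec_injective_of_isUnit ((Matrix.isUnit_iff_isUnit_det _).mpr (by rw [hdet]; exact isUnit_one))
  exact h

/-- The isometry of `ℂP²` induced by a matrix in `SU(3)`. -/
def projAct (A : Matrix.specialUnitaryGroup (Fin 3) ℂ) : CP2 → CP2 :=
  Projectivization.map (Matrix.toLin' (A : Matrix (Fin 3) (Fin 3) ℂ)) (toLin_injective A)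

/-- Equivariance of `f` with respect to all real translations and some one-parameter subgroup
of `SU(3)`. -/
def IsTranslationallyEquivariant (f : ℂ → CP2) : Prop :=
  ∃ R : ℝ → Matrix.specialUnitaryGroup (Fin 3) ℂ,
    Continuous R ∧ R 0 = 1 ∧ (∀ s t, R (s + t) = R s * R t) ∧
      ∀ (t : ℝ) (z : ℂ), f (t + z) = projAct (R t) (f z)

/-- The period lattice of `f`: all `w` with `f (z + w) = f z` for all `z`. -/
def periodLattice (f : ℂ → CP2) : AddSubgroup ℂ where
  carrier := {w | ∀ z, f (z + w) = f z}
  zero_mem' := by intro z; simp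
  add_mem' := by
    intro a b ha hb z
    rw [← add_assoc, hb (z + a), ha z]
  neg_mem' := by
    intro a ha z
    have h := ha (z + -a)
    rw [neg_add_cancel_right] at h
    exact h.symm

/-- `f` has two periods that are linearly independent over `ℝ`. -/
def IsEquivariantTorus (f : ℂ → CP2) : Prop :=
  ∃ w₁ ∈ periodLattice f, ∃ w₂ ∈ periodLattice f, LinearIndependent ℝ ![w₁, w₂]

/-- The gauged frame with columns `-iλ e^{-u/2} F_z`, `(iλ)⁻¹ e^{-u/2} F_z̄`, `F`. -/
def extendedFrame (F : ℂ → C3) (lam : ℂ) (z : ℂ) : Matrix (Fin 3) (Fin 3) ℂ :=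
  Matrix.of fun j =>
    ![-I * lam * (Real.exp (-(metricU F z) / 2) : ℂ) * dz F z j,
      (I * lam)⁻¹ * (Real.exp (-(metricU F z) / 2) : ℂ) * dzbar F z j,
      F z j]

/-- The generating matrix `D(λ) = 𝔽⁻¹ ∂ₓ 𝔽` at `z = 0`, where `𝔽` is the gauged frame.
It does not change when `𝔽` is multiplied from the left by a constant matrix, so `𝔽` need not be
normalized at `z = 0`. -/
def generator (F : ℂ → C3) (lam : ℂ) : Matrix (Fin 3) (Fin 3) ℂ :=
  (extendedFrame F lam 0)⁻¹ *
    Matrix.of fun i j => deriv (fun x : ℝ => extendedFrame F lam (x : ℂ) i j) 0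

/-- The complete elliptic integral of the first kind, as a function of the modulus `k`. -/
def ellipticK (k : ℝ) : ℝ :=
  ∫ α in (0 : ℝ)..(Real.pi / 2), 1 / √(1 - k ^ 2 * Real.sin α ^ 2)

/-- The maximum `a₁` of the conformal factor `e^u`. -/
def a₁ (F : ℂ → C3) : ℝ := ⨆ z, expU F z

/-- `β/2 - a₁ = |ψ|² / (2 a₁²)`, where `|ψ|` is the (constant) modulus of the Hopf coefficient. -/
def delta (F : ℂ → C3) : ℝ := ‖hopf F 0‖ ^ 2 / (2 * a₁ F ^ 2)

/-- The minimum `a₂` of the conformal factor `e^u`. -/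
def a₂ (F : ℂ → C3) : ℝ := (delta F + √(delta F ^ 2 + 4 * a₁ F * delta F)) / 2

/-- `-a₃` is the negative root of `w³ - (β/2) w² + |ψ|²/2`, the other roots being `a₁`, `a₂`. -/
def a₃ (F : ℂ → C3) : ℝ := (-delta F + √(delta F ^ 2 + 4 * a₁ F * delta F)) / 2

/-- `T = K(k) / r` with `k² = (a₁ - a₂) / (a₁ + a₃)` and `r = √(2 (a₁ + a₃))`; then `2T` is the
smallest positive period of the metric in the `y`-direction. -/
def halfPeriod (F : ℂ → C3) : ℝ :=
  ellipticK (√((a₁ F - a₂ F) / (a₁ F + a₃ F))) / √(2 * (a₁ F + a₃ F))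

end

end MinLag

/-! Reality of `λ⁻³ψ` makes the Hopf coefficient `-iρ` with `ρ` real, and `λ` drops out.
Equivariance makes `v = e^u` a function of `y` alone, and the lift then solves a linear system whose
coefficients depend only on `y` (`structureEquations`), with first integral `v'²/4 + ρ² + 2v³ =
βv²`. Consequently `F_xxx = -β F_x + 2iρ F`. The characteristic cubic is that of the generator `D`
(`charpoly_generator`). Its roots are `iδ_j` with `δ = ρ/A₁, ρ/A₂, -ρ/A₃`, where `A₁ > A₂ > 0 > -A₃`
are the roots of `w³ - (β/2)w² + ρ²/2`, so that `A₁` and `A₂` are the maximum and minimum of `v`.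

Split `F` into three components with `G_x = iδ_j G`. Each satisfies `G_yy = (δ_j² - 4v)G`, and at a
critical point of `v` the system also forces `(vδ_j - ρ)G_y = 0` and `(vδ_j² + ρδ_j - 2v²)G = 0`.
Every component is therefore even or odd about a maximum `y₀` of `v` and about the next minimum `y₀
+ T`; the elliptic parametrization of `v` supplies these symmetry axes. Composing the two
reflections, translation by `2Ti` multiplies the components by `-1, -1, +1`.

A horizontal lift is unique up to a constant phase, so `τ` is a period iff `F(z + τ) = c F(z)` with
`c` constant (`mem_periodLattice_iff`). Since `v` must be preserved, `Im τ = 2Tm`, and the condition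
becomes equality of `(-1)^m e^{iδ₀x}`, `(-1)^m e^{iδ₁x}` and `e^{iδ₂x}` with `x = Re τ`
(`exists_periodData`). From this, `4Ti` is always a period and `2Ti` never is, which leaves exactly
the two lattices (`lattice_eq`). A second independent period exists iff there is a nonzero real
period, which, because the `δ_j` sum to zero, means that the eigenvalue ratio is rational
(`rational_iff`). -/

namespace MinLag

open scoped ContDiff Matrix
open Complex

noncomputable section

/-! ### Directional derivatives of maps on the plane. -/

section DirectionalDerivative

variable {E : Type*} [NormedAddCommGroup E] [NormedSpace ℝ E]

/-- The real directional derivative along `v` of a map on `ℂ`. -/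
def pd (v : ℂ) (f : ℂ → E) (z : ℂ) : E := fderiv ℝ f z v

theorem contDiff_pd {f : ℂ → E} (hf : ContDiff ℝ ∞ f) (v : ℂ) : ContDiff ℝ ∞ (pd v f) :=
  (hf.fderiv_right (m := ∞) (by simp)).clm_apply contDiff_const

theorem pd_comm {f : ℂ → E} (hf : ContDiff ℝ ∞ f) (v w : ℂ) :
    pd v (pd w f) = pd w (pd v f) := by
  have hd : Differentiable ℝ (fderiv ℝ f) :=
    (hf.fderiv_right (m := ∞) (by simp)).differentiable (by simp)
  have key : ∀ (a b : ℂ) (z : ℂ), pd a (pd b f) z = fderiv ℝ (fderiv ℝ f) z a b := by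
    intro a b z
    have h : HasFDerivAt (fun z => fderiv ℝ f z b)
        ((ContinuousLinearMap.apply ℝ E b).comp (fderiv ℝ (fderiv ℝ f) z)) z :=
      ((ContinuousLinearMap.apply ℝ E b).hasFDerivAt).comp z (hd z).hasFDerivAt
    change fderiv ℝ (fun z => fderiv ℝ f z b) z a = _
    rw [h.fderiv]
    rfl
  funext z
  rw [key, key]
  exact (hf.contDiffAt.isSymmSndFDerivAt
    (by simpa using WithTop.coe_le_coe.mpr (le_top (a := (2 : ℕ∞))))) v w

theorem hasDerivAt_line {f : ℂ → E} (hf : Differentiable ℝ f) (v z : ℂ) (t : ℝ) :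
    HasDerivAt (fun s : ℝ => f (z + s * v)) (pd v f (z + t * v)) t := by
  have h1 : HasDerivAt (fun s : ℝ => z + (s : ℂ) * v) v t := by
    simpa using ((Complex.ofRealCLM.hasDerivAt (x := t)).mul_const v).const_add z
  exact (hf (z + t * v)).hasFDerivAt.comp_hasDerivAt t h1

theorem hasDerivAt_line_zero {f : ℂ → E} (hf : Differentiable ℝ f) (v z : ℂ) :
    HasDerivAt (fun s : ℝ => f (z + s * v)) (pd v f z) 0 := by
  simpa using hasDerivAt_line hf v z 0

theorem pd_eq_of_hasDerivAt {f : ℂ → E} (hf : Differentiable ℝ f) {v z : ℂ} {e : E}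
    (h : HasDerivAt (fun s : ℝ => f (z + s * v)) e 0) : pd v f z = e :=
  (hasDerivAt_line_zero hf v z).unique h

theorem pd_comp_add (f : ℂ → E) (v w z : ℂ) : pd v (fun z => f (z + w)) z = pd v f (z + w) := by
  simp only [pd]
  rw [fderiv_comp_add_right]

theorem eq_of_pd_eq_zero {f : ℂ → E} (hf : Differentiable ℝ f) (h1 : ∀ z, pd 1 f z = 0)
    (hI : ∀ z, pd I f z = 0) (z w : ℂ) : f z = f w := by
  apply is_const_of_fderiv_eq_zero hf
  intro z
  ext v
  have hv : v = v.re • (1 : ℂ) + v.im • I := by simp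
  have h1' : fderiv ℝ f z 1 = 0 := h1 z
  have hI' : fderiv ℝ f z I = 0 := hI z
  rw [hv, map_add, map_smul, map_smul, h1', hI']
  simp

theorem eq_of_pd_one_eq_zero {f : ℂ → E} (hf : Differentiable ℝ f) (h1 : ∀ z, pd 1 f z = 0)
    (z : ℂ) : f z = f (z.im * I) := by
  have h := is_const_of_deriv_eq_zero (𝕜 := ℝ) (f := fun s : ℝ => f (z.im * I + s * 1))
    (fun s => (hasDerivAt_line hf 1 (z.im * I) s).differentiableAt)
    (fun s => by rw [(hasDerivAt_line hf 1 (z.im * I) s).deriv, h1]) z.re 0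
  simp only [mul_one, ofReal_zero, add_zero] at h
  rw [← h, add_comm, re_add_im]

end DirectionalDerivative

/-! ### The Hermitian product and orthogonal frames. -/

section Hermitian

/-- The Hermitian product `A · conj B` on `ℂ³`. -/
def herm (A B : C3) : ℂ := A ⬝ᵥ star B

theorem herm_add_left (A B C : C3) : herm (A + B) C = herm A C + herm B C := add_dotProduct _ _ _
theorem herm_sub_left (A B C : C3) : herm (A - B) C = herm A C - herm B C := sub_dotProduct _ _ _
theorem herm_neg_left (A B : C3) : herm (-A) B = -herm A B := neg_dotProduct _ _
theorem herm_smul_left (c : ℂ) (A B : C3) : herm (c • A) B = c * herm A B := by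
  simp [herm]
theorem herm_conj (A B : C3) : star (herm A B) = herm B A := by
  simp [herm, dotProduct, mul_comm]
theorem herm_add_right (A B C : C3) : herm A (B + C) = herm A B + herm A C := by
  simp [herm, dotProduct_add]
theorem herm_sub_right (A B C : C3) : herm A (B - C) = herm A B - herm A C := by
  simp [herm, dotProduct_sub]
theorem herm_neg_right (A B : C3) : herm A (-B) = -herm A B := by
  simp [herm]
theorem herm_smul_right (c : ℂ) (A B : C3) : herm A (c • B) = star c * herm A B := by
  simp [herm]

theorem herm_re_comm (A B : C3) : (herm B A).re = (herm A B).re := by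
  rw [← herm_conj A B]; simp
theorem herm_im_comm (A B : C3) : (herm B A).im = -(herm A B).im := by
  rw [← herm_conj A B]; simp

theorem herm_unitary (U : Matrix.specialUnitaryGroup (Fin 3) ℂ) (A B : C3) :
    herm (U.1 *ᵥ A) (U.1 *ᵥ B) = herm A B := by
  have h : star U.1 * U.1 = 1 := Matrix.mem_unitaryGroup_iff'.mp
    (Matrix.mem_specialUnitaryGroup_iff.mp U.2).1
  rw [herm, Matrix.star_mulVec, dotProduct_comm, Matrix.dotProduct_mulVec, Matrix.vecMul_vecMul,
    ← Matrix.star_eq_conjTranspose, h, Matrix.vecMul_one, dotProduct_comm, herm]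

theorem eq_zero_of_herm_frame {X Y Z V : C3} {a b c : ℂ} (ha : a ≠ 0) (hb : b ≠ 0) (hc : c ≠ 0)
    (hXX : herm X X = a) (hYY : herm Y Y = b) (hZZ : herm Z Z = c)
    (hXY : herm X Y = 0) (hXZ : herm X Z = 0) (hYZ : herm Y Z = 0)
    (h1 : herm V X = 0) (h2 : herm V Y = 0) (h3 : herm V Z = 0) : V = 0 := by
  have hYX : herm Y X = 0 := by rw [← herm_conj, hXY, star_zero]
  have hZX : herm Z X = 0 := by rw [← herm_conj, hXZ, star_zero]
  have hZY : herm Z Y = 0 := by rw [← herm_conj, hYZ, star_zero]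
  let N : Matrix (Fin 3) (Fin 3) ℂ := Matrix.of ![star X, star Y, star Z]
  have hN : N * (Matrix.of ![X, Y, Z])ᵀ = Matrix.diagonal ![a, b, c] := by
    have e : ∀ A B : C3, (star A) ⬝ᵥ B = herm B A := fun A B => dotProduct_comm _ _
    ext i j
    rw [Matrix.mul_apply']
    fin_cases i <;> fin_cases j <;>
      simp only [N, Matrix.of_apply, Fin.mk_zero, Fin.mk_one, Fin.reduceFinMk,
        Matrix.transpose_apply, Matrix.diagonal_apply]
    · exact (e X X).trans hXX
    · exact (e X Y).trans hYX
    · exact (e X Z).trans hZX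
    · exact (e Y X).trans hXY
    · exact (e Y Y).trans hYY
    · exact (e Y Z).trans hZY
    · exact (e Z X).trans hXZ
    · exact (e Z Y).trans hYZ
    · exact (e Z Z).trans hZZ
  have hdet : N.det ≠ 0 := by
    intro h0
    have := congrArg Matrix.det hN
    rw [Matrix.det_mul, h0, zero_mul, Matrix.det_diagonal, Fin.prod_univ_three] at this
    exact mul_ne_zero (mul_ne_zero ha hb) hc this.symm
  have hV : N *ᵥ V = 0 := by
    ext i
    have e : ∀ A : C3, (star A) ⬝ᵥ V = herm V A := fun A => dotProduct_comm _ _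
    fin_cases i
    · exact (e X).trans h1
    · exact (e Y).trans h2
    · exact (e Z).trans h3
  exact Matrix.eq_zero_of_mulVec_eq_zero hdet hV

theorem eq_herm_expansion {X Y Z : C3} {a b c : ℝ} (ha : a ≠ 0) (hb : b ≠ 0) (hc : c ≠ 0)
    (hXX : herm X X = a) (hYY : herm Y Y = b) (hZZ : herm Z Z = c)
    (hXY : herm X Y = 0) (hXZ : herm X Z = 0) (hYZ : herm Y Z = 0) (V : C3) :
    V = (herm V X / a) • X + (herm V Y / b) • Y + (herm V Z / c) • Z := by
  have hYX : herm Y X = 0 := by rw [← herm_conj, hXY, star_zero]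
  have hZX : herm Z X = 0 := by rw [← herm_conj, hXZ, star_zero]
  have hZY : herm Z Y = 0 := by rw [← herm_conj, hYZ, star_zero]
  have ha' : (a : ℂ) ≠ 0 := ofReal_ne_zero.mpr ha
  have hb' : (b : ℂ) ≠ 0 := ofReal_ne_zero.mpr hb
  have hc' : (c : ℂ) ≠ 0 := ofReal_ne_zero.mpr hc
  rw [← sub_eq_zero]
  apply eq_zero_of_herm_frame ha' hb' hc' hXX hYY hZZ hXY hXZ hYZ <;>
    simp only [herm_sub_left, herm_add_left, herm_smul_left, *, mul_zero, add_zero, zero_add] <;>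
    field_simp <;> ring

theorem hasDerivAt_herm {a b : ℝ → C3} {a' b' : C3} {t : ℝ} (ha : HasDerivAt a a' t)
    (hb : HasDerivAt b b' t) :
    HasDerivAt (fun s => herm (a s) (b s)) (herm a' (b t) + herm (a t) b') t := by
  have h := HasDerivAt.fun_sum (u := Finset.univ) fun (k : Fin 3) _ =>
    ((hasDerivAt_pi.mp ha k).mul (hasDerivAt_pi.mp hb k).star)
  refine h.congr_deriv ?_
  simp only [herm, dotProduct, Finset.sum_add_distrib, Pi.star_apply]

theorem differentiable_herm {A B : ℂ → C3} (hA : Differentiable ℝ A) (hB : Differentiable ℝ B) :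
    Differentiable ℝ fun z => herm (A z) (B z) := by
  have h1 := differentiable_pi.mp hA
  have h2 := differentiable_pi.mp hB
  simp only [herm, dotProduct, Pi.star_apply]
  exact Differentiable.fun_sum fun k _ => (h1 k).mul (h2 k).star

theorem pd_herm {A B : ℂ → C3} (hA : Differentiable ℝ A) (hB : Differentiable ℝ B) (v z : ℂ) :
    pd v (fun z => herm (A z) (B z)) z = herm (pd v A z) (B z) + herm (A z) (pd v B z) := by
  apply pd_eq_of_hasDerivAt (differentiable_herm hA hB)
  simpa using hasDerivAt_herm (hasDerivAt_line_zero hA v z) (hasDerivAt_line_zero hB v z)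

end Hermitian

end

noncomputable section

/-! ### The orthogonal frame `F_x, F_y, F`, and the phase relating congruent lifts. -/

section FirstOrder

theorem pd_lincomb {A B : ℂ → C3} (hA : Differentiable ℝ A) (hB : Differentiable ℝ B)
    (a b : ℂ) (v z : ℂ) :
    pd v (fun z => a • A z + b • B z) z = a • pd v A z + b • pd v B z := by
  apply pd_eq_of_hasDerivAt ((hA.const_smul a).add (hB.const_smul b))
  exact ((hasDerivAt_line_zero hA v z).const_smul a).add
    ((hasDerivAt_line_zero hB v z).const_smul b)

theorem pd_one_eq (F : ℂ → C3) (z : ℂ) : pd 1 F z = dz F z + dzbar F z := by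
  simp only [dz, dzbar, pd, ← smul_add]
  rw [sub_add_add_cancel, ← two_smul ℂ, smul_smul]; norm_num

theorem pd_I_eq (F : ℂ → C3) (z : ℂ) : pd I F z = I • (dz F z - dzbar F z) := by
  ext k
  simp only [dz, dzbar, pd, Pi.smul_apply, Pi.sub_apply, Pi.add_apply, smul_eq_mul]
  linear_combination (fderiv ℝ F z I k) * I_mul_I

theorem dz_eq (F : ℂ → C3) (z : ℂ) : dz F z = (1 / 2 : ℂ) • pd 1 F z + (-I / 2) • pd I F z := by
  ext k
  simp only [dz, pd, Pi.smul_apply, Pi.sub_apply, Pi.add_apply, smul_eq_mul]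
  ring

theorem dzbar_eq (F : ℂ → C3) (z : ℂ) :
    dzbar F z = (1 / 2 : ℂ) • pd 1 F z + (I / 2) • pd I F z := by
  ext k
  simp only [dzbar, pd, Pi.smul_apply, Pi.add_apply, smul_eq_mul]
  ring

variable {F : ℂ → C3} {f : ℂ → CP2}

namespace IsMinimalLagrangianLift

variable (hF : IsMinimalLagrangianLift F f)

section
include hF

theorem contDiff_pd (v : ℂ) : ContDiff ℝ ∞ (pd v F) := MinLag.contDiff_pd hF.smooth v
theorem contDiff_pd_pd (v w : ℂ) : ContDiff ℝ ∞ (pd v (pd w F)) :=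
  MinLag.contDiff_pd (hF.contDiff_pd w) v
theorem differentiable : Differentiable ℝ F := hF.smooth.differentiable (by simp)
theorem differentiable_pd (v : ℂ) : Differentiable ℝ (pd v F) :=
  (hF.contDiff_pd v).differentiable (by simp)
theorem differentiable_pd_pd (v w : ℂ) : Differentiable ℝ (pd v (pd w F)) :=
  (hF.contDiff_pd_pd v w).differentiable (by simp)

theorem herm_dz_dzbar (z : ℂ) : herm (dz F z) (dzbar F z) = 0 := hF.conformal z
theorem herm_dzbar_dz (z : ℂ) : herm (dzbar F z) (dz F z) = 0 := by
  rw [← herm_conj, hF.herm_dz_dzbar, star_zero]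
theorem herm_dz_dz (z : ℂ) : herm (dz F z) (dz F z) = expU F z := hF.conformal_dz z
theorem herm_dzbar_dzbar (z : ℂ) : herm (dzbar F z) (dzbar F z) = expU F z := hF.conformal_dzbar z
theorem herm_self (z : ℂ) : herm (F z) (F z) = 1 := hF.unit z
theorem ne_zero (z : ℂ) : F z ≠ 0 := (hF.lift z).choose
theorem expU_ne_zero (z : ℂ) : (expU F z : ℂ) ≠ 0 := ofReal_ne_zero.mpr (hF.immersion z).ne'

theorem herm_x_self (z : ℂ) : herm (pd 1 F z) (F z) = 0 := by
  have h1 : herm (dz F z) (F z) = 0 := hF.horizontal_dz z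
  have h2 : herm (dzbar F z) (F z) = 0 := hF.horizontal_dzbar z
  rw [pd_one_eq, herm_add_left, h1, h2, add_zero]

theorem herm_y_self (z : ℂ) : herm (pd I F z) (F z) = 0 := by
  have h1 : herm (dz F z) (F z) = 0 := hF.horizontal_dz z
  have h2 : herm (dzbar F z) (F z) = 0 := hF.horizontal_dzbar z
  rw [pd_I_eq, herm_smul_left, herm_sub_left, h1, h2, sub_zero, mul_zero]

theorem herm_self_x (z : ℂ) : herm (F z) (pd 1 F z) = 0 := by
  rw [← herm_conj, hF.herm_x_self, star_zero]

theorem herm_self_y (z : ℂ) : herm (F z) (pd I F z) = 0 := by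
  rw [← herm_conj, hF.herm_y_self, star_zero]

theorem herm_x_x (z : ℂ) : herm (pd 1 F z) (pd 1 F z) = ((2 * expU F z : ℝ) : ℂ) := by
  simp only [pd_one_eq, herm_add_left, herm_add_right, hF.herm_dz_dz, hF.herm_dz_dzbar,
    hF.herm_dzbar_dz, hF.herm_dzbar_dzbar]
  push_cast; ring

theorem herm_y_y (z : ℂ) : herm (pd I F z) (pd I F z) = ((2 * expU F z : ℝ) : ℂ) := by
  simp only [pd_I_eq, herm_sub_left, herm_sub_right, herm_smul_left, herm_smul_right,
    hF.herm_dz_dz, hF.herm_dz_dzbar, hF.herm_dzbar_dz, hF.herm_dzbar_dzbar]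
  have : star I = -I := conj_I
  rw [this]
  push_cast
  linear_combination (-2 * (expU F z : ℂ)) * I_mul_I

theorem herm_x_y (z : ℂ) : herm (pd 1 F z) (pd I F z) = 0 := by
  simp only [pd_I_eq, pd_one_eq, herm_sub_right, herm_add_left, herm_smul_right,
    hF.herm_dz_dz, hF.herm_dz_dzbar, hF.herm_dzbar_dz, hF.herm_dzbar_dzbar]
  ring

theorem herm_y_x (z : ℂ) : herm (pd I F z) (pd 1 F z) = 0 := by
  rw [← herm_conj, hF.herm_x_y, star_zero]

theorem frame_expansion (z : ℂ) (V : C3) :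
    V = (herm V (pd 1 F z) / (2 * expU F z)) • pd 1 F z +
      (herm V (pd I F z) / (2 * expU F z)) • pd I F z + herm V (F z) • F z := by
  have h2 : 2 * expU F z ≠ 0 := (mul_pos two_pos (hF.immersion z)).ne'
  have h := eq_herm_expansion (c := 1) h2 h2 one_ne_zero (hF.herm_x_x z) (hF.herm_y_y z)
    (by simpa using hF.herm_self z) (hF.herm_x_y z) (hF.herm_x_self z) (hF.herm_y_self z) V
  simpa using h

theorem frame_independent {z : ℂ} {a b c : ℂ}
    (h : a • pd 1 F z + b • pd I F z + c • F z = 0) : a = 0 ∧ b = 0 ∧ c = 0 := by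
  have h2 : ((2 * expU F z : ℝ) : ℂ) ≠ 0 :=
    ofReal_ne_zero.mpr (mul_pos two_pos (hF.immersion z)).ne'
  have h0 : ∀ V : C3, herm 0 V = 0 := fun V => by simp [herm]
  refine ⟨?_, ?_, ?_⟩
  · have := congrArg (fun V => herm V (pd 1 F z)) h
    simpa [herm_add_left, herm_smul_left, hF.herm_x_x, hF.herm_y_x, hF.herm_self_x, h0,
      hF.expU_ne_zero] using this
  · have := congrArg (fun V => herm V (pd I F z)) h
    simpa [herm_add_left, herm_smul_left, hF.herm_y_y, hF.herm_x_y, hF.herm_self_y, h0,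
      hF.expU_ne_zero] using this
  · have := congrArg (fun V => herm V (F z)) h
    simpa [herm_add_left, herm_smul_left, hF.herm_x_self, hF.herm_y_self, hF.herm_self, h0]
      using this

end

/-- A horizontal lift of a translate that is congruent to `f` differs from the translated lift by a
constant phase. -/
theorem exists_phase (hF : IsMinimalLagrangianLift F f) {τ : ℂ}
    (U : Matrix.specialUnitaryGroup (Fin 3) ℂ) (h : ∀ z, f (z + τ) = projAct U (f z)) :
    ∃ c : ℂ, ∀ z, F (z + τ) = c • (U.1 *ᵥ F z) := by
  have hUF : ∀ z, ∃ a : ℂ, a ≠ 0 ∧ a • (U.1 *ᵥ F z) = F (z + τ) := by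
    intro z
    obtain ⟨h1, e1⟩ := hF.lift (z + τ)
    obtain ⟨h2, e2⟩ := hF.lift z
    have e := h z
    rw [e1, e2, projAct, Projectivization.map_mk, Projectivization.mk_eq_mk_iff'] at e
    obtain ⟨a, ha⟩ := e
    refine ⟨a, ?_, ha⟩
    rintro rfl
    exact h1 (by rw [← ha, zero_smul])
  have hlin : ∀ (v z : ℂ), HasDerivAt (fun s : ℝ => U.1 *ᵥ F (z + s * v)) (U.1 *ᵥ pd v F z) 0 := by
    intro v z
    have := ((Matrix.toLin' U.1).toContinuousLinearMap.restrictScalars ℝ).hasFDerivAt.comp_hasDerivAt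
      (0 : ℝ) (hasDerivAt_line_zero hF.differentiable v z)
    exact this
  have hdU : Differentiable ℝ fun z => U.1 *ᵥ F z :=
    ((Matrix.toLin' U.1).toContinuousLinearMap.restrictScalars ℝ).differentiable.comp
      hF.differentiable
  have hdT : Differentiable ℝ fun z => F (z + τ) :=
    hF.differentiable.comp (differentiable_id.add_const τ)
  have hdk := differentiable_herm hdT hdU
  -- The phase itself is recovered as a Hermitian product, hence is differentiable. Both terms of
  -- its derivative vanish by horizontality, at `z + τ` and at `z`; the pointwise scalar `a` is
  -- never differentiated.
  have hk : ∀ v : ℂ, (∀ z, herm (pd v F z) (F z) = 0) →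
      ∀ z, pd v (fun z => herm (F (z + τ)) (U.1 *ᵥ F z)) z = 0 := by
    intro v hv z
    have hv' : herm (F z) (pd v F z) = 0 := by rw [← herm_conj, hv, star_zero]
    obtain ⟨a, ha0, ha⟩ := hUF z
    have ha' : U.1 *ᵥ F z = a⁻¹ • F (z + τ) := by rw [← ha, smul_smul, inv_mul_cancel₀ ha0, one_smul]
    rw [pd_herm hdT hdU, pd_comp_add, pd_eq_of_hasDerivAt hdU (hlin v z), ← ha, herm_smul_left,
      herm_unitary, hv', ha', herm_smul_right, hv]
    simp
  refine ⟨herm (F (0 + τ)) (U.1 *ᵥ F 0), fun z => ?_⟩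
  rw [eq_of_pd_eq_zero hdk (hk 1 hF.herm_x_self) (hk I hF.herm_y_self) 0 z]
  obtain ⟨a, ha0, ha⟩ := hUF z
  rw [← ha, herm_smul_left, herm_unitary, hF.herm_self, mul_one]

theorem norm_phase (hF : IsMinimalLagrangianLift F f) {τ c : ℂ}
    {U : Matrix.specialUnitaryGroup (Fin 3) ℂ} {z : ℂ}
    (h : F (z + τ) = c • (U.1 *ᵥ F z)) : c * star c = 1 := by
  have := hF.herm_self (z + τ)
  rwa [h, herm_smul_left, herm_smul_right, herm_unitary, hF.herm_self, mul_one] at this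

theorem expU_translate (hF : IsMinimalLagrangianLift F f) {τ : ℂ}
    (U : Matrix.specialUnitaryGroup (Fin 3) ℂ) (h : ∀ z, f (z + τ) = projAct U (f z)) (z : ℂ) :
    expU F (z + τ) = expU F z := by
  obtain ⟨c, hc⟩ := hF.exists_phase U h
  have hpd : pd 1 F (z + τ) = c • (U.1 *ᵥ pd 1 F z) := by
    have h1 := hasDerivAt_line_zero hF.differentiable 1 (z + τ)
    have h2 := (((Matrix.toLin' U.1).toContinuousLinearMap.restrictScalars
      ℝ).hasFDerivAt.comp_hasDerivAt (0 : ℝ)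
      (hasDerivAt_line_zero hF.differentiable 1 z)).const_smul c
    refine h1.unique (h2.congr_of_eventuallyEq (Filter.Eventually.of_forall fun s => ?_))
    have : z + τ + s * 1 = (z + s * 1) + τ := by ring
    simp only [this, hc]
    rfl
  have h3 := hF.herm_x_x (z + τ)
  rw [hpd, herm_smul_left, herm_smul_right, herm_unitary, ← mul_assoc, hF.norm_phase (hc z),
    one_mul, hF.herm_x_x] at h3
  have := ofReal_injective h3
  linarith

theorem mem_periodLattice_iff (hF : IsMinimalLagrangianLift F f) (τ : ℂ) :
    τ ∈ periodLattice f ↔ ∃ c : ℂ, ∀ z, F (z + τ) = c • F z := by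
  constructor
  · intro h
    obtain ⟨c, hc⟩ := hF.exists_phase (τ := τ) 1 (by
      intro z
      rw [show f (z + τ) = f z from h z]
      obtain ⟨h2, e2⟩ := hF.lift z
      rw [e2, projAct, Projectivization.map_mk]
      simp)
    exact ⟨c, fun z => by simpa using hc z⟩
  · rintro ⟨c, hc⟩ z
    obtain ⟨h1, e1⟩ := hF.lift (z + τ)
    obtain ⟨h2, e2⟩ := hF.lift z
    rw [e1, e2, Projectivization.mk_eq_mk_iff']
    exact ⟨c, (hc z).symm⟩

theorem expU_period (hF : IsMinimalLagrangianLift F f) {τ : ℂ} (h : τ ∈ periodLattice f) (z : ℂ) :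
    expU F (z + τ) = expU F z := by
  refine hF.expU_translate 1 (fun z => ?_) z
  rw [show f (z + τ) = f z from h z]
  obtain ⟨h2, e2⟩ := hF.lift z
  rw [e2, projAct, Projectivization.map_mk]
  simp

theorem expU_add_real (hF : IsMinimalLagrangianLift F f) (he : IsTranslationallyEquivariant f)
    (z : ℂ) (t : ℝ) : expU F (z + t) = expU F z := by
  obtain ⟨R, -, -, -, hR⟩ := he
  exact hF.expU_translate (R t) (fun z => by rw [add_comm]; exact hR t z) z

end IsMinimalLagrangianLift
end FirstOrder
end

noncomputable section

/-! ### Second-order structure equations and their compatibility. -/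

section SecondOrder

theorem pd_ofReal {g : ℂ → ℝ} (hg : Differentiable ℝ g) (v z : ℂ) :
    pd v (fun z => ((g z : ℝ) : ℂ)) z = ((pd v g z : ℝ) : ℂ) := by
  apply pd_eq_of_hasDerivAt (ofRealCLM.differentiable.comp hg)
  exact (hasDerivAt_line_zero hg v z).ofReal_comp

theorem pd_const_mul {g : ℂ → ℝ} (hg : Differentiable ℝ g) (c : ℝ) (v z : ℂ) :
    pd v (fun z => c * g z) z = c * pd v g z := by
  apply pd_eq_of_hasDerivAt (hg.const_mul c)
  exact (hasDerivAt_line_zero hg v z).const_mul c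

theorem contDiff_herm {A B : ℂ → C3} (hA : ContDiff ℝ ∞ A) (hB : ContDiff ℝ ∞ B) :
    ContDiff ℝ ∞ fun z => herm (A z) (B z) := by
  have h1 := contDiff_pi.mp hA
  have h2 := contDiff_pi.mp hB
  simp only [herm, dotProduct, Pi.star_apply]
  exact ContDiff.sum fun k _ => (h1 k).mul (conjCLE.contDiff.comp (h2 k))

theorem herm_leibniz {A B : ℂ → C3} (hA : Differentiable ℝ A) (hB : Differentiable ℝ B)
    {φ : ℂ → ℂ} (h : ∀ z, herm (A z) (B z) = φ z) (v z : ℂ) :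
    herm (pd v A z) (B z) + herm (A z) (pd v B z) = pd v φ z := by
  rw [← pd_herm hA hB, show (fun z => herm (A z) (B z)) = φ from funext h]

theorem pd_zero_fun (v z : ℂ) : pd v (fun _ : ℂ => (0 : ℂ)) z = 0 := by simp [pd]

variable {F : ℂ → C3} {f : ℂ → CP2}

namespace IsMinimalLagrangianLift

section
variable (hF : IsMinimalLagrangianLift F f)
include hF

theorem contDiff_expU : ContDiff ℝ ∞ (expU F) := by
  have h : expU F = fun z => (1 / 2) * (herm (pd 1 F z) (pd 1 F z)).re := by
    funext z; rw [hF.herm_x_x, ofReal_re]; ring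
  rw [h]
  exact contDiff_const.mul (reCLM.contDiff.comp (contDiff_herm (hF.contDiff_pd 1) (hF.contDiff_pd 1)))

theorem differentiable_expU : Differentiable ℝ (expU F) := hF.contDiff_expU.differentiable (by simp)

theorem differentiable_pd_expU (v : ℂ) : Differentiable ℝ (pd v (expU F)) :=
  (MinLag.contDiff_pd hF.contDiff_expU v).differentiable (by simp)

theorem pd_I_pd_one (z : ℂ) : pd I (pd 1 F) z = pd 1 (pd I F) z := by
  rw [pd_comm hF.smooth]

theorem herm_xx_self (z : ℂ) : herm (pd 1 (pd 1 F) z) (F z) = -(2 * expU F z) := by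
  have h := herm_leibniz (hF.differentiable_pd 1) hF.differentiable hF.herm_x_self 1 z
  rw [pd_zero_fun, hF.herm_x_x] at h
  push_cast at h
  linear_combination h

theorem herm_yy_self (z : ℂ) : herm (pd I (pd I F) z) (F z) = -(2 * expU F z) := by
  have h := herm_leibniz (hF.differentiable_pd I) hF.differentiable hF.herm_y_self I z
  rw [pd_zero_fun, hF.herm_y_y] at h
  push_cast at h
  linear_combination h

theorem herm_xy_self (z : ℂ) : herm (pd 1 (pd I F) z) (F z) = 0 := by
  have h := herm_leibniz (hF.differentiable_pd I) hF.differentiable hF.herm_y_self 1 z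
  rwa [pd_zero_fun, hF.herm_y_x, add_zero] at h

theorem pd_dz (v z : ℂ) : pd v (dz F) z = (1 / 2 : ℂ) • pd v (pd 1 F) z + (-I / 2) • pd v (pd I F) z := by
  rw [← pd_lincomb (hF.differentiable_pd 1) (hF.differentiable_pd I), ← funext (dz_eq F)]

/-- The equation `F_xx + F_yy = -4 e^u F`. -/
theorem laplace (z : ℂ) : pd I (pd I F) z = -((4 * expU F z : ℂ) • F z) - pd 1 (pd 1 F) z := by
  have hm := hF.minimal z
  rw [meanCurvature, smul_eq_zero_iff_right (inv_ne_zero (hF.expU_ne_zero z)), sub_eq_zero] at hm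
  have e : dzbar (dz F) z = (1 / 4 : ℂ) • (pd 1 (pd 1 F) z + pd I (pd I F) z) := by
    rw [dzbar_eq, hF.pd_dz, hF.pd_dz, hF.pd_I_pd_one]
    ext k
    simp only [Pi.smul_apply, Pi.add_apply, smul_eq_mul]
    linear_combination (-(1 / 4) * pd I (pd I F) z k) * I_mul_I
  have e2 : dzbar (dz F) z ⬝ᵥ star (F z) = -(expU F z) := by
    change herm _ _ = _
    rw [e, herm_smul_left, herm_add_left, hF.herm_xx_self, hF.herm_yy_self]
    ring
  rw [e2, e] at hm
  ext k
  have hk := congrFun hm k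
  simp only [Pi.smul_apply, Pi.add_apply, smul_eq_mul, Pi.sub_apply, Pi.neg_apply] at hk ⊢
  linear_combination 4 * hk

end

section
variable (hF : IsMinimalLagrangianLift F f) (hx : ∀ z, pd 1 (expU F) z = 0)
  {ρ : ℂ → ℝ} (hρ : ∀ z, hopf F z = -I * ρ z)
include hF hx hρ

/-- Differentiating the orthogonality relations of the frame and eliminating `F_yy` by `laplace`
gives real linear equations for these products; the Hopf coefficient supplies the remaining ones. -/
theorem herm_second (z : ℂ) :
    herm (pd 1 (pd 1 F) z) (pd 1 F z) = -(2 * I * ρ z) ∧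
    herm (pd 1 (pd 1 F) z) (pd I F z) = -((pd I (expU F) z : ℝ) : ℂ) ∧
    herm (pd 1 (pd I F) z) (pd 1 F z) = ((pd I (expU F) z : ℝ) : ℂ) ∧
    herm (pd 1 (pd I F) z) (pd I F z) = 2 * I * ρ z := by
  have dX := hF.differentiable_pd 1
  have dY := hF.differentiable_pd I
  have p2 : ∀ v : ℂ, pd v (fun z => ((2 * expU F z : ℝ) : ℂ)) z = ((2 * pd v (expU F) z : ℝ) : ℂ) := by
    intro v
    rw [pd_ofReal (hF.differentiable_expU.const_mul 2), pd_const_mul hF.differentiable_expU]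
  have h1 := herm_leibniz dX dX hF.herm_x_x 1 z
  have h2 := herm_leibniz dX dX hF.herm_x_x I z
  have h3 := herm_leibniz dY dY hF.herm_y_y 1 z
  have h5 := herm_leibniz dX dY hF.herm_x_y 1 z
  have h6 := herm_leibniz dX dY hF.herm_x_y I z
  have hh := hρ z
  have hh' : herm (pd 1 (dz F) z - I • pd I (dz F) z) (dzbar F z) = 2 * (-I * ρ z) := by
    rw [← hh, hopf]
    change herm _ _ = 2 * herm _ _
    rw [← herm_smul_left]
    congr 1
    rw [dz_eq (dz F)]
    ext k
    simp only [Pi.smul_apply, Pi.add_apply, smul_eq_mul, Pi.sub_apply]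
    ring
  rw [hF.pd_dz, hF.pd_dz, dzbar_eq] at hh'
  rw [p2, hx] at h1 h3
  rw [p2] at h2
  rw [pd_zero_fun] at h5 h6
  simp only [hF.pd_I_pd_one, hF.laplace, herm_sub_right, herm_neg_right, herm_smul_right,
    herm_sub_left, herm_add_left, herm_smul_left, herm_add_right, herm_neg_left,
    hF.herm_x_self, hF.herm_self_x, hF.herm_self_y] at h1 h2 h3 h5 h6 hh'
  simp only [Complex.ext_iff] at h1 h2 h3 h5 h6 hh' ⊢
  simp [herm_re_comm (pd 1 (pd 1 F) z) (pd 1 F z), herm_im_comm (pd 1 (pd 1 F) z) (pd 1 F z),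
    herm_re_comm (pd 1 (pd I F) z) (pd 1 F z), herm_im_comm (pd 1 (pd I F) z) (pd 1 F z),
    herm_re_comm (pd 1 (pd I F) z) (pd I F z), herm_im_comm (pd 1 (pd I F) z) (pd I F z)]
    at h1 h2 h3 h5 h6 hh' ⊢
  norm_num [Complex.div_re, Complex.div_im] at hh'
  refine ⟨⟨?_, ?_⟩, ⟨?_, ?_⟩, ⟨?_, ?_⟩, ?_, ?_⟩ <;> linarith

theorem structure_xx (z : ℂ) : pd 1 (pd 1 F) z =
    (-(I * ρ z) / expU F z) • pd 1 F z + (-((pd I (expU F) z : ℝ) : ℂ) / (2 * expU F z)) • pd I F z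
      + (-(2 * (expU F z : ℂ))) • F z := by
  obtain ⟨h1, h2, -, -⟩ := hF.herm_second hx hρ z
  have h := hF.frame_expansion z (pd 1 (pd 1 F) z)
  rw [h1, h2, hF.herm_xx_self] at h
  rw [h]
  congr 3
  have := hF.expU_ne_zero z
  field_simp

theorem structure_xy (z : ℂ) : pd 1 (pd I F) z =
    (((pd I (expU F) z : ℝ) : ℂ) / (2 * expU F z)) • pd 1 F z + ((I * ρ z) / expU F z) • pd I F z := by
  obtain ⟨-, -, h1, h2⟩ := hF.herm_second hx hρ z
  have h := hF.frame_expansion z (pd 1 (pd I F) z)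
  rw [h1, h2, hF.herm_xy_self, zero_smul, add_zero] at h
  rw [h]
  congr 2
  have := hF.expU_ne_zero z
  field_simp

/-- The compatibility conditions of the structure equations. -/
theorem compatibility (hdρ : Differentiable ℝ ρ) (z : ℂ) : pd 1 ρ z = 0 ∧ pd I ρ z = 0 ∧
    expU F z * pd I (pd I (expU F)) z = (pd I (expU F) z) ^ 2 + 4 * ρ z ^ 2 - 4 * expU F z ^ 3 := by
  have dX := hF.differentiable_pd 1
  have dY := hF.differentiable_pd I
  have dXX := hF.differentiable_pd_pd 1 1
  have dXY := hF.differentiable_pd_pd 1 I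
  have hw := hF.differentiable_pd_expU I
  have hwx : pd 1 (pd I (expU F)) z = 0 := by
    rw [pd_comm hF.contDiff_expU, show pd 1 (expU F) = fun _ => 0 from funext hx]
    simp [pd]
  have hsec := hF.herm_second hx hρ
  have pI : ∀ (c : ℝ) (v : ℂ), pd v (fun z => c * I * (ρ z : ℂ)) z = c * I * ((pd v ρ z : ℝ) : ℂ) := by
    intro c v
    apply pd_eq_of_hasDerivAt ((ofRealCLM.differentiable.comp hdρ).const_mul _)
    exact (hasDerivAt_line_zero hdρ v z).ofReal_comp.const_mul _
  have k1 := herm_leibniz dXX dX (φ := fun z => ((-2 : ℝ) : ℂ) * I * ρ z)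
    (fun z => by rw [(hsec z).1]; push_cast; ring) I z
  have k2 := herm_leibniz dXY dX (fun z => (hsec z).2.2.1) 1 z
  have k3 := herm_leibniz dXY dY (φ := fun z => ((2 : ℝ) : ℂ) * I * ρ z)
    (fun z => by rw [(hsec z).2.2.2]; push_cast; ring) 1 z
  have k4 := herm_leibniz dXX dY (φ := fun z => ((-pd I (expU F) z : ℝ) : ℂ))
    (fun z => by rw [(hsec z).2.1]; push_cast; ring) I z
  have hc : pd I (pd 1 (pd 1 F)) z = pd 1 (pd 1 (pd I F)) z := by
    rw [pd_comm (hF.contDiff_pd 1), pd_comm hF.smooth I 1]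
  rw [pI, hc, hF.pd_I_pd_one] at k1
  rw [pd_ofReal hw, hwx] at k2
  rw [pI] at k3
  have hneg : pd I (fun z => -pd I (expU F) z) z = -pd I (pd I (expU F)) z := by
    have := pd_const_mul hw (-1) I z
    simpa using this
  rw [pd_ofReal (g := fun z => -pd I (expU F) z) hw.neg, hc, hneg] at k4
  -- In `e1` and `e2` the third derivatives cancel because partial derivatives commute. What remains
  -- is Codazzi (`ρ` constant) in `e1` and the imaginary part of `e2`, and Gauss in the real part of
  -- `e2`.
  have e1 : herm (pd 1 (pd 1 F) z) (pd 1 (pd I F) z) - herm (pd 1 (pd I F) z) (pd 1 (pd 1 F) z) =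
      -2 * I * ((pd I ρ z : ℝ) : ℂ) := by push_cast at k1 k2; linear_combination k1 - k2
  have e2 : herm (pd 1 (pd I F) z) (pd 1 (pd I F) z) - herm (pd 1 (pd 1 F) z) (pd I (pd I F) z) =
      2 * I * ((pd 1 ρ z : ℝ) : ℂ) + ((pd I (pd I (expU F)) z : ℝ) : ℂ) := by
    push_cast at k3 k4; linear_combination k3 - k4
  rw [hF.laplace, hF.structure_xx hx hρ, hF.structure_xy hx hρ] at e2
  rw [hF.structure_xx hx hρ, hF.structure_xy hx hρ] at e1
  simp only [herm_sub_right, herm_neg_right, herm_smul_right, herm_add_left,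
    herm_smul_left, herm_add_right, hF.herm_x_self, hF.herm_self_x, hF.herm_self_y,
    hF.herm_y_self, hF.herm_x_x, hF.herm_y_y, hF.herm_x_y, hF.herm_y_x, hF.herm_self] at e1 e2
  have hw0 := (hF.immersion z).ne'
  have hwc := hF.expU_ne_zero z
  simp at e1 e2
  field_simp at e1 e2
  simp only [Complex.ext_iff] at e1 e2
  simp [pow_succ] at e1 e2
  exact ⟨e2.2.resolve_left hw0, e1.resolve_left hw0, by linear_combination (-1 / 2) * e2.1⟩

end

end IsMinimalLagrangianLift
end SecondOrder
end

noncomputable section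

/-! ### Uniqueness for planar linear systems. -/

section LinearODE

/-- A solution of the planar linear system `e' = a q`, `q' = b e` with vanishing initial value is
zero. -/
theorem linear_system_eq_zero {E : Type*} [NormedAddCommGroup E] [NormedSpace ℝ E]
    {e q : ℝ → E} {a b : ℝ → ℝ} (ha : Continuous a) (hb : Continuous b)
    (he : ∀ t, HasDerivAt e (a t • q t) t) (hq : ∀ t, HasDerivAt q (b t • e t) t)
    {t₀ : ℝ} (he0 : e t₀ = 0) (hq0 : q t₀ = 0) (t : ℝ) : e t = 0 := by
  -- The extra `1` puts `t` inside an open interval about `t₀` on whose closure compactness bounds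
  -- the coefficients.
  set N := |t - t₀| + 1 with hN
  have hN0 : 0 < N := by positivity
  obtain ⟨C₁, hC₁⟩ := (isCompact_Icc (a := t₀ - N) (b := t₀ + N)).exists_bound_of_continuousOn
    ha.continuousOn
  obtain ⟨C₂, hC₂⟩ := (isCompact_Icc (a := t₀ - N) (b := t₀ + N)).exists_bound_of_continuousOn
    hb.continuousOn
  set K : NNReal := Real.toNNReal (max C₁ C₂) with hK
  have hKge : max C₁ C₂ ≤ K := Real.le_coe_toNNReal _
  have hlip : ∀ s ∈ Set.Ioo (t₀ - N) (t₀ + N),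
      LipschitzOnWith K (fun p : E × E => (a s • p.2, b s • p.1)) Set.univ := by
    intro s hs
    have h1 : ‖a s‖ ≤ K := (hC₁ s ⟨hs.1.le, hs.2.le⟩).trans ((le_max_left _ _).trans hKge)
    have h2 : ‖b s‖ ≤ K := (hC₂ s ⟨hs.1.le, hs.2.le⟩).trans ((le_max_right _ _).trans hKge)
    apply LipschitzWith.lipschitzOnWith
    apply LipschitzWith.of_dist_le_mul
    intro x y
    rw [Prod.dist_eq]
    apply max_le
    · change dist (a s • x.2) (a s • y.2) ≤ _
      rw [dist_smul₀]
      exact mul_le_mul h1 (le_max_right _ _) dist_nonneg K.2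
    · change dist (b s • x.1) (b s • y.1) ≤ _
      rw [dist_smul₀]
      exact mul_le_mul h2 (le_max_left _ _) dist_nonneg K.2
  have h := ODE_solution_unique_of_mem_Ioo (v := fun s (p : E × E) => (a s • p.2, b s • p.1))
    (s := fun _ => Set.univ) (f := fun s => (e s, q s)) (g := fun _ => (0, 0)) hlip
    (t₀ := t₀) ⟨by linarith, by linarith⟩
    (fun s _ => ⟨(he s).prodMk (hq s), trivial⟩)
    (fun s _ => ⟨(hasDerivAt_const s ((0 : E), (0 : E))).congr_deriv (by simp; rfl), trivial⟩)
    (by simp [he0, hq0])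
  have ht : t ∈ Set.Ioo (t₀ - N) (t₀ + N) := by
    have := abs_le.mp (le_refl |t - t₀|)
    constructor <;> linarith
  exact congrArg Prod.fst (h ht)

end LinearODE

/-! ### Elliptic integrals and the amplitude parametrization of the conformal factor. -/

section EllipticIntegral

/-- The incomplete elliptic integral of the first kind divided by `r`. -/
def ellipticF (k r α : ℝ) : ℝ := (∫ x in (0 : ℝ)..α, 1 / √(1 - k ^ 2 * Real.sin x ^ 2)) / r

variable {k r : ℝ}

theorem elliptic_pos (hk : k ^ 2 < 1) (α : ℝ) : 0 < 1 - k ^ 2 * Real.sin α ^ 2 := by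
  have h1 := Real.sin_sq_le_one α
  have := mul_le_mul_of_nonneg_left h1 (sq_nonneg k)
  linarith

theorem hasDerivAt_ellipticF (hk : k ^ 2 < 1) (r α : ℝ) :
    HasDerivAt (ellipticF k r) (1 / √(1 - k ^ 2 * Real.sin α ^ 2) / r) α := by
  have hc : Continuous fun x => 1 / √(1 - k ^ 2 * Real.sin x ^ 2) :=
    continuous_const.div (by fun_prop) fun x => (Real.sqrt_pos.mpr (elliptic_pos hk x)).ne'
  exact (intervalIntegral.integral_hasDerivAt_right (hc.intervalIntegrable 0 α)
    hc.stronglyMeasurable.stronglyMeasurableAtFilter hc.continuousAt).div_const r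

theorem ellipticF_zero (k r : ℝ) : ellipticF k r 0 = 0 := by simp [ellipticF]

theorem ellipticF_pi_div_two (k r : ℝ) : ellipticF k r (Real.pi / 2) = ellipticK k / r := rfl

theorem ellipticF_neg (hk : k ^ 2 < 1) (r α : ℝ) : ellipticF k r (-α) = -ellipticF k r α := by
  have hd : ∀ x, HasDerivAt (fun x => ellipticF k r (-x) + ellipticF k r x) 0 x := by
    intro x
    have h1 := (hasDerivAt_ellipticF hk r (-x)).comp x (hasDerivAt_neg x)
    refine (h1.add (hasDerivAt_ellipticF hk r x)).congr_deriv ?_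
    rw [Real.sin_neg, neg_sq]; ring
  have := is_const_of_deriv_eq_zero (fun x => (hd x).differentiableAt) (fun x => (hd x).deriv) α 0
  simp only [neg_zero, ellipticF_zero, add_zero] at this
  linarith

theorem ellipticF_add_pi (hk : k ^ 2 < 1) (r α : ℝ) :
    ellipticF k r (α + Real.pi) = ellipticF k r α + 2 * (ellipticK k / r) := by
  have hd : ∀ x, HasDerivAt (fun x => ellipticF k r (x + Real.pi) - ellipticF k r x) 0 x := by
    intro x
    have h1 := (hasDerivAt_ellipticF hk r (x + Real.pi)).comp_add_const x Real.pi
    refine (h1.sub (hasDerivAt_ellipticF hk r x)).congr_deriv ?_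
    rw [Real.sin_add_pi, neg_sq]; ring
  have := is_const_of_deriv_eq_zero (fun x => (hd x).differentiableAt) (fun x => (hd x).deriv) α
    (-(Real.pi / 2))
  simp only [ellipticF_neg hk] at this
  rw [show -(Real.pi / 2) + Real.pi = Real.pi / 2 by ring, ellipticF_pi_div_two] at this
  linarith

theorem ellipticF_int_mul_pi (hk : k ^ 2 < 1) (r : ℝ) (n : ℤ) :
    ellipticF k r (n * Real.pi) = n * (2 * (ellipticK k / r)) := by
  induction n using Int.induction_on with
  | zero => simp [ellipticF_zero]
  | succ i ih =>
    push_cast at ih ⊢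
    rw [add_mul, one_mul, ellipticF_add_pi hk, ih]; ring
  | pred i ih =>
    have := ellipticF_add_pi hk r (((-i : ℤ) - 1 : ℤ) * Real.pi)
    push_cast at ih this ⊢
    rw [show (-(i : ℝ) - 1) * Real.pi + Real.pi = -i * Real.pi by ring, ih] at this
    linarith

/-- The integrand is at least `1`, so the integral grows at least like `x / r`; oddness handles the
other end. Surjectivity lets every `y` be written through an amplitude. -/
theorem ellipticF_surjective (hk : k ^ 2 < 1) (hr : 0 < r) : Function.Surjective (ellipticF k r) := by
  have hcont : Continuous (ellipticF k r) :=
    continuous_iff_continuousAt.mpr fun x => (hasDerivAt_ellipticF hk r x).continuousAt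
  have hd : ∀ x, HasDerivAt (fun x => ellipticF k r x - x / r)
      (1 / √(1 - k ^ 2 * Real.sin x ^ 2) / r - 1 / r) x := fun x =>
    (hasDerivAt_ellipticF hk r x).sub ((hasDerivAt_id x).div_const r)
  have hmono : Monotone fun x => ellipticF k r x - x / r := by
    apply monotone_of_deriv_nonneg fun x => (hd x).differentiableAt
    intro x
    rw [(hd x).deriv, ← sub_div]
    apply div_nonneg _ hr.le
    rw [sub_nonneg, le_div_iff₀ (Real.sqrt_pos.mpr (elliptic_pos hk x)), one_mul, Real.sqrt_le_one]
    have : 0 ≤ k ^ 2 * Real.sin x ^ 2 := by positivity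
    linarith
  have htop : Filter.Tendsto (ellipticF k r) Filter.atTop Filter.atTop := by
    refine Filter.tendsto_atTop_mono' _ ?_ (Filter.tendsto_id.atTop_div_const hr)
    filter_upwards [Filter.eventually_ge_atTop 0] with x hx
    have := hmono hx
    simp only [ellipticF_zero, zero_div, sub_zero] at this
    simpa using this
  refine hcont.surjective htop ?_
  have : ellipticF k r = fun x => -ellipticF k r (-x) := by
    funext x; rw [ellipticF_neg hk, neg_neg]
  rw [this]
  exact Filter.tendsto_neg_atTop_atBot.comp (htop.comp Filter.tendsto_neg_atBot_atTop)

theorem hasDerivAt_elliptic_momentum (hk : k ^ 2 < 1) (c α : ℝ) :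
    HasDerivAt (fun x => c * (Real.sin x * Real.cos x * √(1 - k ^ 2 * Real.sin x ^ 2)))
      (c * (((1 - k ^ 2 * Real.sin α ^ 2) * (Real.cos α ^ 2 - Real.sin α ^ 2) -
        k ^ 2 * Real.sin α ^ 2 * Real.cos α ^ 2) / √(1 - k ^ 2 * Real.sin α ^ 2))) α := by
  have hp := elliptic_pos hk α
  have h1 := ((((Real.hasDerivAt_sin α).pow 2).const_mul (k ^ 2)).const_sub 1).sqrt hp.ne'
  have h2 := (((Real.hasDerivAt_sin α).mul (Real.hasDerivAt_cos α)).mul h1).const_mul c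
  refine h2.congr_deriv ?_
  have hs := (Real.sqrt_pos.mpr hp).ne'
  have hsq := Real.sq_sqrt hp.le
  congr 1
  simp only [Pi.mul_apply, Pi.pow_apply]
  push_cast
  set σ := √(1 - k ^ 2 * Real.sin α ^ 2)
  rw [← hsq]
  field_simp
  ring

variable {A₁ A₂ A₃ : ℝ}

/-- The conformal factor in terms of the amplitude. -/
theorem exists_amplitude (h2 : 0 < A₂) (h21 : A₂ < A₁) (h3 : 0 < A₃)
    (hrel : A₁ * A₂ = A₃ * (A₁ + A₂)) {w w₁ : ℝ → ℝ} (hw : ∀ y, HasDerivAt w (w₁ y) y)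
    (hw₁ : ∀ y, HasDerivAt w₁ (8 * (A₁ + A₂ - A₃) * w y - 12 * w y ^ 2) y)
    (hen : ∀ y, w₁ y ^ 2 = 8 * (A₁ - w y) * (w y - A₂) * (w y + A₃)) (hpos : ∀ y, 0 < w y) :
    ∃ y₀, ∀ α, w (y₀ + ellipticF √((A₁ - A₂) / (A₁ + A₃)) √(2 * (A₁ + A₃)) α) =
      A₁ - (A₁ - A₂) * Real.sin α ^ 2 := by
  have h13 : 0 < A₁ + A₃ := by linarith
  have h12 : 0 < A₁ - A₂ := by linarith
  set k := √((A₁ - A₂) / (A₁ + A₃)) with hkdef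
  set r := √(2 * (A₁ + A₃)) with hrdef
  have hksq : k ^ 2 = (A₁ - A₂) / (A₁ + A₃) := Real.sq_sqrt (div_pos h12 h13).le
  have hrsq : r ^ 2 = 2 * (A₁ + A₃) := Real.sq_sqrt (by linarith)
  have hr : 0 < r := Real.sqrt_pos.mpr (by linarith)
  have hk : k ^ 2 < 1 := by rw [hksq, div_lt_one h13]; linarith
  -- The energy identity and `w > 0` confine `w 0` to `[A₂, A₁]`, so an initial amplitude exists.
  have hbound : 0 ≤ (A₁ - w 0) / (A₁ - A₂) ∧ (A₁ - w 0) / (A₁ - A₂) ≤ 1 := by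
    have e := hen 0
    have p := hpos 0
    have hnn : 0 ≤ (A₁ - w 0) * (w 0 - A₂) := by
      have h0 : 0 ≤ (A₁ - w 0) * (w 0 - A₂) * (w 0 + A₃) := by nlinarith [sq_nonneg (w₁ 0)]
      exact nonneg_of_mul_nonneg_left h0 (by linarith)
    rw [div_le_one h12]
    constructor
    · apply div_nonneg _ h12.le
      by_contra! hc
      nlinarith
    · by_contra! hc
      nlinarith
  set c := -2 * (A₁ - A₂) * r with hc
  let P : ℝ → ℝ := fun x => c * (Real.sin x * Real.cos x * √(1 - k ^ 2 * Real.sin x ^ 2))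
  let H : ℝ → ℝ := fun x => A₁ - (A₁ - A₂) * Real.sin x ^ 2
  have hPsq : ∀ α, P α ^ 2 = 8 * (A₁ - H α) * (H α - A₂) * (H α + A₃) := by
    intro α
    have hs := Real.sq_sqrt (elliptic_pos hk α).le
    have hcs : Real.cos α ^ 2 = 1 - Real.sin α ^ 2 := Real.cos_sq' α
    simp only [P, H, hc]
    calc _ = 4 * (A₁ - A₂) ^ 2 * r ^ 2 * Real.sin α ^ 2 * Real.cos α ^ 2 *
          √(1 - k ^ 2 * Real.sin α ^ 2) ^ 2 := by ring
      _ = _ := by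
        rw [hs, hrsq, hcs, hksq]
        field_simp
        ring
  -- The energy identity fixes the initial velocity only up to sign; replacing `α` by `-α` flips
  -- that sign and keeps `H`.
  obtain ⟨α₀, hH0, hP0⟩ : ∃ α₀, H α₀ = w 0 ∧ P α₀ = w₁ 0 := by
    have hsin : Real.sin (Real.arcsin √((A₁ - w 0) / (A₁ - A₂))) = √((A₁ - w 0) / (A₁ - A₂)) := by
      apply Real.sin_arcsin
      · linarith [Real.sqrt_nonneg ((A₁ - w 0) / (A₁ - A₂))]
      · rw [Real.sqrt_le_one]; exact hbound.2
    set α := Real.arcsin √((A₁ - w 0) / (A₁ - A₂))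
    have hH : H α = w 0 := by
      simp only [H]
      rw [hsin, Real.sq_sqrt hbound.1]
      field_simp
      ring
    have hsq : P α ^ 2 = w₁ 0 ^ 2 := by rw [hPsq, hH, hen]
    rcases sq_eq_sq_iff_eq_or_eq_neg.mp hsq with h | h
    · exact ⟨α, hH, h⟩
    · refine ⟨-α, ?_, ?_⟩
      · rw [← hH]; simp [H]
      · simp only [P] at h ⊢
        rw [Real.sin_neg, Real.cos_neg, neg_sq]
        linarith
  refine ⟨-ellipticF k r α₀, fun α => ?_⟩
  let S : ℝ → ℝ := fun x => -ellipticF k r α₀ + ellipticF k r x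
  let s : ℝ → ℝ := fun x => 1 / √(1 - k ^ 2 * Real.sin x ^ 2) / r
  have hS : ∀ x, HasDerivAt S (s x) x := fun x => (hasDerivAt_ellipticF hk r x).const_add _
  have hs : Continuous s :=
    (continuous_const.div (by fun_prop) fun x =>
      (Real.sqrt_pos.mpr (elliptic_pos hk x)).ne').div_const r
  have hH' : ∀ x, HasDerivAt H (s x * P x) x := by
    intro x
    have h1 := (((Real.hasDerivAt_sin x).pow 2).const_mul (A₁ - A₂)).const_sub A₁
    refine h1.congr_deriv ?_
    have hs := (Real.sqrt_pos.mpr (elliptic_pos hk x)).ne'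
    simp only [s, P, hc]
    field_simp
    push_cast
    ring
  have hP' : ∀ x, HasDerivAt P (s x * (8 * (A₁ + A₂ - A₃) * H x - 12 * H x ^ 2)) x := by
    intro x
    refine (hasDerivAt_elliptic_momentum hk c x).congr_deriv ?_
    have hs := (Real.sqrt_pos.mpr (elliptic_pos hk x)).ne'
    have hcs : Real.cos x ^ 2 = 1 - Real.sin x ^ 2 := Real.cos_sq' x
    simp only [s, hc, H]
    rw [hcs]
    generalize √(1 - k ^ 2 * Real.sin x ^ 2) = σ at hs
    rw [hksq]
    field_simp
    rw [hrsq]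
    generalize Real.sin x ^ 2 = q
    linear_combination (-4 * (A₁ + A₃)) * hrel
  have hwS : ∀ x, HasDerivAt (fun x => w (S x)) (s x * w₁ (S x)) x := fun x =>
    ((hw (S x)).comp x (hS x)).congr_deriv (mul_comm _ _)
  have hw₁S : ∀ x, HasDerivAt (fun x => w₁ (S x))
      (s x * (8 * (A₁ + A₂ - A₃) * w (S x) - 12 * w (S x) ^ 2)) x := fun x =>
    ((hw₁ (S x)).comp x (hS x)).congr_deriv (mul_comm _ _)
  have hcw : Continuous fun x => w (S x) :=
    continuous_iff_continuousAt.mpr fun x => (hwS x).continuousAt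
  have hcH : Continuous H := continuous_iff_continuousAt.mpr fun x => (hH' x).continuousAt
  have hS0 : S α₀ = 0 := by simp [S]
  -- Uniqueness is applied to the second-order equation, since the energy equation fails to be
  -- Lipschitz at turning points. The difference of the quadratic terms factors, so the differences
  -- solve a linear system.
  have key := linear_system_eq_zero (e := fun x => w (S x) - H x) (q := fun x => w₁ (S x) - P x)
    (a := s) (b := fun x => s x * (8 * (A₁ + A₂ - A₃) - 12 * (w (S x) + H x)))
    hs (hs.mul (continuous_const.sub (continuous_const.mul (hcw.add hcH))))
    (fun x => ((hwS x).sub (hH' x)).congr_deriv (by simp only [smul_eq_mul]; ring))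
    (fun x => ((hw₁S x).sub (hP' x)).congr_deriv (by simp only [smul_eq_mul]; ring))
    (t₀ := α₀) (by simp [hS0, hH0]) (by simp [hS0, hP0]) α
  exact sub_eq_zero.mp key

end EllipticIntegral
end

noncomputable section

/-! ### Symmetries of the conformal factor and roots of its cubic. -/

section Profile

variable {A₁ A₂ A₃ : ℝ}

/-- Symmetry and range of the conformal factor along the `y`-direction. -/
theorem exists_profile (h2 : 0 < A₂) (h21 : A₂ < A₁) (h3 : 0 < A₃)
    (hrel : A₁ * A₂ = A₃ * (A₁ + A₂)) {w w₁ : ℝ → ℝ} (hw : ∀ y, HasDerivAt w (w₁ y) y)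
    (hw₁ : ∀ y, HasDerivAt w₁ (8 * (A₁ + A₂ - A₃) * w y - 12 * w y ^ 2) y)
    (hen : ∀ y, w₁ y ^ 2 = 8 * (A₁ - w y) * (w y - A₂) * (w y + A₃)) (hpos : ∀ y, 0 < w y)
    {T : ℝ} (hT : T = ellipticK √((A₁ - A₂) / (A₁ + A₃)) / √(2 * (A₁ + A₃))) :
    ∃ y₀, w y₀ = A₁ ∧ w (y₀ + T) = A₂ ∧ (∀ s, w (y₀ + s) = w (y₀ - s)) ∧
      (∀ s, w (y₀ + T + s) = w (y₀ + T - s)) ∧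
      (∀ s, w (y₀ + s) = A₁ → ∃ n : ℤ, s = n * (2 * T)) ∧ (∀ y, w y ≤ A₁) := by
  obtain ⟨y₀, hy₀⟩ := exists_amplitude h2 h21 h3 hrel hw hw₁ hen hpos
  have h13 : 0 < A₁ + A₃ := by linarith
  have h12 : 0 < A₁ - A₂ := by linarith
  have hk : √((A₁ - A₂) / (A₁ + A₃)) ^ 2 < 1 := by
    rw [Real.sq_sqrt (div_pos h12 h13).le, div_lt_one h13]; linarith
  have hr : 0 < √(2 * (A₁ + A₃)) := Real.sqrt_pos.mpr (by linarith)
  generalize √((A₁ - A₂) / (A₁ + A₃)) = k at *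
  generalize √(2 * (A₁ + A₃)) = r at *
  have hsurj := ellipticF_surjective hk hr
  have heven : ∀ s, w (y₀ + s) = w (y₀ - s) := by
    intro s
    obtain ⟨α, rfl⟩ := hsurj s
    rw [sub_eq_add_neg, ← ellipticF_neg hk, hy₀, hy₀, Real.sin_neg, neg_sq]
  have hper : ∀ s, w (y₀ + (s + 2 * T)) = w (y₀ + s) := by
    intro s
    obtain ⟨α, rfl⟩ := hsurj s
    rw [hT, ← ellipticF_add_pi hk, hy₀, hy₀, Real.sin_add_pi, neg_sq]
  refine ⟨y₀, ?_, ?_, heven, ?_, ?_, ?_⟩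
  · have := hy₀ 0
    rw [ellipticF_zero] at this
    simpa using this
  · have := hy₀ (Real.pi / 2)
    rw [ellipticF_pi_div_two, ← hT] at this
    simpa using this
  · intro s
    -- Evenness about `y₀` combined with period `2T` gives evenness about `y₀ + T`.
    rw [show y₀ + T - s = y₀ + (T - s) by ring, heven,
      show y₀ - (T - s) = y₀ + (-T + s) by ring, ← hper]
    congr 1; ring
  · intro s hs
    obtain ⟨α, rfl⟩ := hsurj s
    rw [hy₀] at hs
    have h0 : (A₁ - A₂) * Real.sin α ^ 2 = 0 := by linarith
    have hsin : Real.sin α = 0 := by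
      rcases mul_eq_zero.mp h0 with h | h
      · exact absurd h h12.ne'
      · exact pow_eq_zero_iff two_ne_zero |>.mp h
    obtain ⟨n, rfl⟩ := Real.sin_eq_zero_iff.mp hsin
    exact ⟨n, by rw [ellipticF_int_mul_pi hk, hT]⟩
  · intro y
    obtain ⟨α, hα⟩ := hsurj (y - y₀)
    have := hy₀ α
    rw [hα, add_sub_cancel] at this
    rw [this]
    have := mul_nonneg h12.le (sq_nonneg (Real.sin α))
    linarith

/-- The roots of the cubic polynomial governing the conformal factor. -/
theorem exists_cubic_roots {β ρ w₀ : ℝ} (hρ : ρ ≠ 0) (hw₀ : 0 < w₀)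
    (hneg : w₀ ^ 3 - β / 2 * w₀ ^ 2 + ρ ^ 2 / 2 < 0) :
    ∃ A₁ A₂ A₃ : ℝ, 0 < A₂ ∧ A₂ < A₁ ∧ 0 < A₃ ∧ A₁ * A₂ = A₃ * (A₁ + A₂) ∧
      β = 2 * (A₁ + A₂ - A₃) ∧ ρ ^ 2 = 2 * (A₁ * A₂ * A₃) ∧
      A₂ = (ρ ^ 2 / (2 * A₁ ^ 2) + √((ρ ^ 2 / (2 * A₁ ^ 2)) ^ 2 + 4 * A₁ * (ρ ^ 2 / (2 * A₁ ^ 2)))) / 2 ∧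
      A₃ = (-(ρ ^ 2 / (2 * A₁ ^ 2)) +
        √((ρ ^ 2 / (2 * A₁ ^ 2)) ^ 2 + 4 * A₁ * (ρ ^ 2 / (2 * A₁ ^ 2)))) / 2 := by
  have hρ2 : 0 < ρ ^ 2 := by positivity
  have hβ : w₀ < β := by
    by_contra! h
    have : β / 2 * w₀ ^ 2 ≤ w₀ / 2 * w₀ ^ 2 := by gcongr
    nlinarith [pow_pos hw₀ 3]
  have hcont : ContinuousOn (fun t : ℝ => t ^ 3 - β / 2 * t ^ 2 + ρ ^ 2 / 2) (Set.Icc w₀ β) := by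
    fun_prop
  -- The cubic is negative at `w₀` and positive at `β`, so it has a root above `w₀`. Dividing by
  -- that linear factor leaves the quadratic whose roots are `A₂` and `-A₃`.
  obtain ⟨A₁, hA₁, hroot⟩ := intermediate_value_Icc hβ.le hcont
    (show (0 : ℝ) ∈ Set.Icc _ _ from ⟨hneg.le, by
      have : 0 < β := hw₀.trans hβ
      have := pow_pos this 3
      nlinarith⟩)
  simp only at hroot
  have hlt : w₀ < A₁ := lt_of_le_of_ne hA₁.1 (by rintro rfl; linarith)
  have hA₁0 : 0 < A₁ := hw₀.trans hlt
  set δ := ρ ^ 2 / (2 * A₁ ^ 2) with hδ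
  have hδ0 : 0 < δ := by positivity
  have hδρ : ρ ^ 2 = 2 * A₁ ^ 2 * δ := by rw [hδ]; field_simp
  have hβδ : β = 2 * (A₁ + δ) := by
    have : A₁ ^ 2 * (β - 2 * (A₁ + δ)) = 0 := by linear_combination -2 * hroot + hδρ
    have := (mul_eq_zero.mp this).resolve_left (by positivity)
    linarith
  set σ := √(δ ^ 2 + 4 * A₁ * δ) with hσ
  have hσsq : σ ^ 2 = δ ^ 2 + 4 * A₁ * δ := Real.sq_sqrt (by positivity)
  have hσδ : δ < σ := by
    rw [hσ]; apply Real.lt_sqrt_of_sq_lt; nlinarith [mul_pos hA₁0 hδ0]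
  refine ⟨A₁, (δ + σ) / 2, (-δ + σ) / 2, by linarith, ?_, by linarith, ?_, ?_, ?_, rfl, rfl⟩
  -- With `w₀ < A₁ ≤ A₂` the factored cubic would be nonnegative at `w₀`.
  · by_contra! hle
    have hfac : w₀ ^ 3 - β / 2 * w₀ ^ 2 + ρ ^ 2 / 2 =
        (w₀ - A₁) * ((w₀ - (δ + σ) / 2) * (w₀ + (-δ + σ) / 2)) := by
      rw [hβδ, hδρ]; linear_combination (w₀ - A₁) / 4 * hσsq
    rw [hfac] at hneg
    have : 0 ≤ (w₀ - A₁) * ((w₀ - (δ + σ) / 2) * (w₀ + (-δ + σ) / 2)) := by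
      apply mul_nonneg_of_nonpos_of_nonpos (by linarith)
      apply mul_nonpos_of_nonpos_of_nonneg <;> linarith
    linarith
  · linear_combination (-1 / 4) * hσsq
  · rw [hβδ]; ring
  · rw [hδρ]; linear_combination (-A₁ / 2) * hσsq

end Profile

/-! ### Parity of solutions of `g'' = b g` about a symmetry axis of `b`. -/

section Parity

variable {E : Type*} [NormedAddCommGroup E] [NormedSpace ℝ E] {g g₁ : ℝ → E} {b : ℝ → ℝ} {c : ℝ}

/-- The difference `g (c + s) - g (c - s)` solves the same linear equation in `s`, with zero initial
data once `g₁ c = 0`. For odd parity the sum takes its place. -/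
theorem even_of_deriv_eq_zero (hb : Continuous b) (hg : ∀ y, HasDerivAt g (g₁ y) y)
    (hg₁ : ∀ y, HasDerivAt g₁ (b y • g y) y) (hsymm : ∀ s, b (c + s) = b (c - s))
    (h0 : g₁ c = 0) (s : ℝ) : g (c + s) = g (c - s) := by
  have h := linear_system_eq_zero (e := fun s => g (c + s) - g (c - s))
    (q := fun s => g₁ (c + s) + g₁ (c - s)) (a := fun _ => 1) (b := fun s => b (c + s))
    continuous_const (by fun_prop)
    (fun s => (((hg _).comp_const_add c s).sub ((hg _).comp_const_sub c s)).congr_deriv (by simp))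
    (fun s => (((hg₁ _).comp_const_add c s).add ((hg₁ _).comp_const_sub c s)).congr_deriv
      (by
        rw [smul_sub, show b (c + s) • g (c - s) = b (c - s) • g (c - s) by rw [hsymm]]; abel))
    (t₀ := 0) (by simp) (by simp [h0]) s
  exact sub_eq_zero.mp h

theorem odd_of_eq_zero (hb : Continuous b) (hg : ∀ y, HasDerivAt g (g₁ y) y)
    (hg₁ : ∀ y, HasDerivAt g₁ (b y • g y) y) (hsymm : ∀ s, b (c + s) = b (c - s))
    (h0 : g c = 0) (s : ℝ) : g (c + s) = -g (c - s) := by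
  have h := linear_system_eq_zero (e := fun s => g (c + s) + g (c - s))
    (q := fun s => g₁ (c + s) - g₁ (c - s)) (a := fun _ => 1) (b := fun s => b (c + s))
    continuous_const (by fun_prop)
    (fun s => (((hg _).comp_const_add c s).add ((hg _).comp_const_sub c s)).congr_deriv
      (by simp [sub_eq_add_neg]))
    (fun s => (((hg₁ _).comp_const_add c s).sub ((hg₁ _).comp_const_sub c s)).congr_deriv
      (by
        rw [smul_add, show b (c + s) • g (c - s) = b (c - s) • g (c - s) by rw [hsymm]]; abel))
    (t₀ := 0) (by simp [h0]) (by simp) s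
  exact add_eq_zero_iff_eq_neg.mp h

end Parity
end

/-! ### The linear system for the lift and its spectral components along `x`. -/

noncomputable section

/-- The linear system satisfied by an equivariant minimal Lagrangian lift with conformal factor
`v (im z)`, `v' = v₁`, and Hopf coefficient `-iρ`. -/
structure StructureEquations (v v₁ : ℝ → ℝ) (ρ : ℝ) (G : ℂ → C3) : Prop where
  smooth : ContDiff ℝ ∞ G
  xx : ∀ z, (v z.im : ℂ) • pd 1 (pd 1 G) z =
    (-(v₁ z.im / 2) : ℂ) • pd I G z + (-(I * ρ)) • pd 1 G z + (-(2 * (v z.im : ℂ) ^ 2)) • G z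
  xy : ∀ z, (v z.im : ℂ) • pd 1 (pd I G) z =
    (v₁ z.im / 2 : ℂ) • pd 1 G z + (I * ρ) • pd I G z
  laplace : ∀ z, pd I (pd I G) z = (-(4 * v z.im : ℂ)) • G z - pd 1 (pd 1 G) z

namespace StructureEquations

variable {v v₁ : ℝ → ℝ} {ρ : ℝ} {G H : ℂ → C3}

theorem differentiable (h : StructureEquations v v₁ ρ G) : Differentiable ℝ G :=
  h.smooth.differentiable (by simp)

theorem lincomb (hG : StructureEquations v v₁ ρ G) (hH : StructureEquations v v₁ ρ H) (a b : ℂ) :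
    StructureEquations v v₁ ρ fun z => a • G z + b • H z := by
  have e0 : ∀ w : ℂ, pd w (fun z => a • G z + b • H z) = fun z => a • pd w G z + b • pd w H z :=
    fun w => funext (pd_lincomb hG.differentiable hH.differentiable a b w)
  have e1 : ∀ u w : ℂ, pd u (fun z => a • pd w G z + b • pd w H z) =
      fun z => a • pd u (pd w G) z + b • pd u (pd w H) z := fun u w => funext (pd_lincomb
    ((contDiff_pd hG.smooth w).differentiable (by simp))
    ((contDiff_pd hH.smooth w).differentiable (by simp)) a b u)
  refine ⟨(hG.smooth.const_smul a).add (hH.smooth.const_smul b), fun z => ?_, fun z => ?_,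
    fun z => ?_⟩
  · rw [e0, e1, e0]
    linear_combination (norm := module) a • hG.xx z + b • hH.xx z
  · rw [e0, e1, e0]
    linear_combination (norm := module) a • hG.xy z + b • hH.xy z
  · rw [e0, e1, e0, e1]
    linear_combination (norm := module) a • hG.laplace z + b • hH.laplace z

theorem hasDerivAt_im_smul {A : ℂ → C3} (hA : Differentiable ℝ A) (c : ℝ → ℂ) (z : ℂ) :
    HasDerivAt (fun s : ℝ => c (z + s * 1).im • A (z + s * 1)) (c z.im • pd 1 A z) 0 := by
  have h : ∀ s : ℝ, (z + s * 1).im = z.im := fun s => by simp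
  simp only [h]
  exact (hasDerivAt_line_zero hA 1 z).const_smul (c z.im)

/-- The coefficients depend on `y` only, so differentiating along `x` preserves the system. -/
theorem pd_one (h : StructureEquations v v₁ ρ G) : StructureEquations v v₁ ρ (pd 1 G) := by
  have d0 := h.differentiable
  have s1 := fun w => contDiff_pd h.smooth w
  have d1 : ∀ w, Differentiable ℝ (pd w G) := fun w => (s1 w).differentiable (by simp)
  have d2 : ∀ u w, Differentiable ℝ (pd u (pd w G)) := fun u w =>
    (contDiff_pd (s1 w) u).differentiable (by simp)
  have c1 : pd I (pd 1 G) = pd 1 (pd I G) := pd_comm h.smooth _ _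
  have c2 : pd I (pd 1 (pd I G)) = pd 1 (pd I (pd I G)) := pd_comm (s1 I) _ _
  refine ⟨s1 1, fun z => ?_, fun z => ?_, fun z => ?_⟩
  · rw [c1]
    have l := hasDerivAt_im_smul (d2 1 1) (fun y => (v y : ℂ)) z
    have r := ((hasDerivAt_im_smul (d1 I) (fun y => (-(v₁ y / 2) : ℂ)) z).add
      (hasDerivAt_im_smul (d1 1) (fun _ => (-(I * ρ))) z)).add
      (hasDerivAt_im_smul d0 (fun y => -(2 * (v y : ℂ) ^ 2)) z)
    exact l.unique (r.congr_of_eventuallyEq (Filter.Eventually.of_forall fun s => h.xx _))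
  · rw [c1]
    have l := hasDerivAt_im_smul (d2 1 I) (fun y => (v y : ℂ)) z
    have r := (hasDerivAt_im_smul (d1 1) (fun y => (v₁ y / 2 : ℂ)) z).add
      (hasDerivAt_im_smul (d1 I) (fun _ => I * ρ) z)
    exact l.unique (r.congr_of_eventuallyEq (Filter.Eventually.of_forall fun s => h.xy _))
  · rw [c1, c2]
    have l := hasDerivAt_line_zero (d2 I I) 1 z
    have r := (hasDerivAt_im_smul d0 (fun y => -(4 * v y : ℂ)) z).sub
      (hasDerivAt_line_zero (d2 1 1) 1 z)
    exact l.unique (r.congr_of_eventuallyEq (Filter.Eventually.of_forall fun s => h.laplace _))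

/-- Applying the `xx` equation to `G_x` and eliminating `G_xy` and `G_xx` leaves coefficients in
`v`, `v₁` that the first integral collapses to constants. -/
theorem cubic (h : StructureEquations v v₁ ρ G) {β : ℝ} (hpos : ∀ y, 0 < v y)
    (hβ : ∀ y, v₁ y ^ 2 / 4 + ρ ^ 2 + 2 * v y ^ 3 = β * v y ^ 2) (z : ℂ) :
    pd 1 (pd 1 (pd 1 G)) z = (-(β : ℂ)) • pd 1 G z + (2 * I * ρ) • G z := by
  have c1 : pd I (pd 1 G) = pd 1 (pd I G) := pd_comm h.smooth _ _
  have h1 := h.pd_one.xx z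
  rw [c1] at h1
  have h2 := h.xx z
  have h3 := h.xy z
  have hv : (v z.im : ℂ) ≠ 0 := ofReal_ne_zero.mpr (hpos z.im).ne'
  have hb : ((v₁ z.im : ℂ)) ^ 2 / 4 + (ρ : ℂ) ^ 2 + 2 * (v z.im : ℂ) ^ 3 = β * (v z.im : ℂ) ^ 2 := by
    exact_mod_cast congrArg ((↑) : ℝ → ℂ) (hβ z.im)
  ext k
  have k1 := congrFun h1 k
  have k2 := congrFun h2 k
  have k3 := congrFun h3 k
  simp only [Pi.add_apply, Pi.smul_apply, smul_eq_mul] at k1 k2 k3 ⊢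
  apply mul_left_cancel₀ (pow_ne_zero 2 hv)
  linear_combination (v z.im : ℂ) * k1 - (v₁ z.im / 2 : ℂ) * k3 - I * ρ * k2 - pd 1 G z k * hb
    + (ρ ^ 2 * pd 1 G z k) * I_mul_I

section Eigen

variable {δ : ℝ}

theorem eigen_xy (h : StructureEquations v v₁ ρ G) (hδ : ∀ z, pd 1 G z = (I * δ) • G z) (z : ℂ) :
    pd 1 (pd I G) z = (I * δ) • pd I G z := by
  rw [pd_comm h.smooth, show pd 1 G = fun z => (I * δ : ℂ) • G z from funext hδ]
  exact pd_eq_of_hasDerivAt (h.differentiable.const_smul (I * δ : ℂ))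
    ((hasDerivAt_line_zero h.differentiable I z).const_smul (I * δ : ℂ))

theorem eigen_xx (h : StructureEquations v v₁ ρ G) (hδ : ∀ z, pd 1 G z = (I * δ) • G z) (z : ℂ) :
    pd 1 (pd 1 G) z = (-(δ : ℂ) ^ 2) • G z := by
  have : pd 1 (pd 1 G) z = (I * δ) • pd 1 G z := by
    nth_rewrite 1 [show pd 1 G = fun z => (I * δ : ℂ) • G z from funext hδ]
    exact pd_eq_of_hasDerivAt (h.differentiable.const_smul (I * δ : ℂ))
      ((hasDerivAt_line_zero h.differentiable 1 z).const_smul (I * δ : ℂ))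
  rw [this, hδ, smul_smul]
  congr 1
  linear_combination (δ : ℂ) ^ 2 * I_mul_I

/-- Together with `eigen_second` this decides parity: where `v₁ = 0`, one relation forces `G = 0`
and the other `G_y = 0`, unless its coefficient vanishes. -/
theorem eigen_first (h : StructureEquations v v₁ ρ G) (hδ : ∀ z, pd 1 G z = (I * δ) • G z)
    (z : ℂ) : (v₁ z.im / 2 : ℂ) • pd I G z =
      ((v z.im * δ ^ 2 + ρ * δ - 2 * v z.im ^ 2 : ℝ) : ℂ) • G z := by
  have hx := h.xx z
  rw [h.eigen_xx hδ, hδ] at hx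
  ext k
  have hk := congrFun hx k
  simp only [Pi.add_apply, Pi.smul_apply, smul_eq_mul] at hk ⊢
  push_cast
  linear_combination hk - (ρ * δ * G z k) * I_mul_I

theorem eigen_second (h : StructureEquations v v₁ ρ G) (hδ : ∀ z, pd 1 G z = (I * δ) • G z)
    (z : ℂ) : ((v z.im * δ - ρ : ℝ) : ℂ) • pd I G z = (v₁ z.im / 2 * δ : ℂ) • G z := by
  have hx := h.xy z
  rw [h.eigen_xy hδ, hδ] at hx
  ext k
  have hk := congrFun hx k
  simp only [Pi.add_apply, Pi.smul_apply, smul_eq_mul] at hk ⊢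
  push_cast
  apply mul_left_cancel₀ I_ne_zero
  linear_combination hk

theorem eigen_yy (h : StructureEquations v v₁ ρ G) (hδ : ∀ z, pd 1 G z = (I * δ) • G z)
    (z : ℂ) : pd I (pd I G) z = (δ ^ 2 - 4 * v z.im) • G z := by
  rw [h.laplace, h.eigen_xx hδ, ← sub_smul]
  ext k
  simp only [Pi.smul_apply, smul_eq_mul, real_smul]
  push_cast; ring

theorem eigen_translate_real (h : StructureEquations v v₁ ρ G)
    (hδ : ∀ z, pd 1 G z = (I * δ) • G z) (z : ℂ) (x : ℝ) :
    G (z + x) = Complex.exp (I * δ * x) • G z := by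
  have hd : ∀ s : ℝ, HasDerivAt (fun s : ℝ => Complex.exp (-(I * δ * s)) • G (z + s * 1)) 0 s := by
    intro s
    have h1 : HasDerivAt (fun s : ℝ => -(I * δ * s)) (-(I * δ)) s := by
      simpa using! ((ofRealCLM.hasDerivAt (x := s)).const_mul (I * δ : ℂ)).fun_neg
    refine (h1.cexp.smul (hasDerivAt_line h.differentiable 1 z s)).congr_deriv ?_
    rw [hδ, smul_smul, ← add_smul]
    convert zero_smul ℂ _ using 2
    ring
  have hc := is_const_of_deriv_eq_zero (fun s => (hd s).differentiableAt) (fun s => (hd s).deriv) x 0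
  simp only [mul_one, ofReal_zero, mul_zero, neg_zero, Complex.exp_zero, one_smul, add_zero] at hc
  rw [← hc, smul_smul, ← Complex.exp_add, add_neg_cancel, Complex.exp_zero, one_smul]

theorem eigen_hasDerivAt (h : StructureEquations v v₁ ρ G)
    (hδ : ∀ z, pd 1 G z = (I * δ) • G z) :
    (∀ y : ℝ, HasDerivAt (fun y : ℝ => G (y * I)) (pd I G (y * I)) y) ∧
    (∀ y : ℝ, HasDerivAt (fun y : ℝ => pd I G (y * I)) ((δ ^ 2 - 4 * v y) • G (y * I)) y) := by
  refine ⟨fun y => ?_, fun y => ?_⟩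
  · simpa using hasDerivAt_line h.differentiable I 0 y
  · have := hasDerivAt_line ((contDiff_pd h.smooth I).differentiable (by simp)) I 0 y
    simp only [zero_add] at this
    rw [h.eigen_yy hδ] at this
    simpa using this

theorem eigen_even (h : StructureEquations v v₁ ρ G) (hδ : ∀ z, pd 1 G z = (I * δ) • G z)
    (hv : Continuous v) {c : ℝ} (hsymm : ∀ s, v (c + s) = v (c - s)) (hc : v₁ c = 0)
    (hne : v c * δ - ρ ≠ 0) (s : ℝ) : G ((c + s : ℝ) * I) = G ((c - s : ℝ) * I) := by
  refine even_of_deriv_eq_zero (b := fun y => δ ^ 2 - 4 * v y) (by fun_prop)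
    (h.eigen_hasDerivAt hδ).1 (h.eigen_hasDerivAt hδ).2 (fun s => by rw [hsymm]) ?_ s
  have h2 := h.eigen_second hδ (c * I)
  simp only [mul_I_im, ofReal_re, hc, ofReal_zero, zero_div, zero_mul, zero_smul] at h2
  exact (smul_eq_zero.mp h2).resolve_left (ofReal_ne_zero.mpr hne)

theorem eigen_odd (h : StructureEquations v v₁ ρ G) (hδ : ∀ z, pd 1 G z = (I * δ) • G z)
    (hv : Continuous v) {c : ℝ} (hsymm : ∀ s, v (c + s) = v (c - s)) (hc : v₁ c = 0)
    (hne : v c * δ ^ 2 + ρ * δ - 2 * v c ^ 2 ≠ 0) (s : ℝ) :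
    G ((c + s : ℝ) * I) = -G ((c - s : ℝ) * I) := by
  refine odd_of_eq_zero (b := fun y => δ ^ 2 - 4 * v y) (by fun_prop)
    (h.eigen_hasDerivAt hδ).1 (h.eigen_hasDerivAt hδ).2 (fun s => by rw [hsymm]) ?_ s
  have h2 := h.eigen_first hδ (c * I)
  simp only [mul_I_im, ofReal_re, hc, ofReal_zero, zero_div, zero_smul] at h2
  exact (smul_eq_zero.mp h2.symm).resolve_left (ofReal_ne_zero.mpr hne)

/-- Two reflections of signs `a` and `b` compose to a translation of sign `a b`. -/
theorem eigen_translate_imag (h : StructureEquations v v₁ ρ G)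
    (hδ : ∀ z, pd 1 G z = (I * δ) • G z) {y₀ T : ℝ} {a b : ℂ}
    (h1 : ∀ s : ℝ, G ((y₀ + s : ℝ) * I) = a • G ((y₀ - s : ℝ) * I))
    (h2 : ∀ s : ℝ, G ((y₀ + T + s : ℝ) * I) = b • G ((y₀ + T - s : ℝ) * I)) (z : ℂ) :
    G (z + 2 * T * I) = (a * b) • G z := by
  have hy : ∀ y : ℝ, G ((y + 2 * T : ℝ) * I) = (a * b) • G (y * I) := by
    intro y
    have e1 := h2 (y - y₀ + T)
    have e2 := h1 (y₀ - y)
    rw [show y₀ + T + (y - y₀ + T) = y + 2 * T by ring,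
      show y₀ + T - (y - y₀ + T) = y₀ + (y₀ - y) by ring, e2,
      show y₀ - (y₀ - y) = y by ring, smul_smul] at e1
    rw [e1, mul_comm]
  have e1 := h.eigen_translate_real hδ ((z.im + 2 * T : ℝ) * I) z.re
  have e2 := h.eigen_translate_real hδ (z.im * I) z.re
  rw [hy, smul_comm] at e1
  have hz : (z.im : ℂ) * I + z.re = z := by rw [add_comm, re_add_im]
  rw [hz] at e2
  rw [← e2] at e1
  rw [← e1]
  congr 1
  push_cast
  linear_combination -hz

end Eigen

/-- The product `(∂ₓ - ia)(∂ₓ - ib)` of differential operators. -/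
def resolvent (a b : ℝ) (G : ℂ → C3) (z : ℂ) : C3 :=
  pd 1 (pd 1 G) z + ((-(I * (a + b))) • pd 1 G z + (-(a * b : ℂ)) • G z)

theorem resolvent_structure (h : StructureEquations v v₁ ρ G) (a b : ℝ) :
    StructureEquations v v₁ ρ (resolvent a b G) := by
  have := h.pd_one.pd_one.lincomb (h.pd_one.lincomb h (-(I * (a + b))) (-(a * b : ℂ))) 1 1
  simp only [one_smul] at this
  exact this

/-- By Vieta, `(∂ₓ - iδ)(∂ₓ - ia)(∂ₓ - ib)` is the operator that `cubic` shows to annihilate `G`. -/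
theorem resolvent_eigen (h : StructureEquations v v₁ ρ G) {β : ℝ} (hpos : ∀ y, 0 < v y)
    (hβ : ∀ y, v₁ y ^ 2 / 4 + ρ ^ 2 + 2 * v y ^ 3 = β * v y ^ 2) {δ a b : ℝ}
    (e1 : δ + a + b = 0) (e2 : δ * a + δ * b + a * b = -β) (e3 : δ * a * b = -(2 * ρ)) (z : ℂ) :
    pd 1 (resolvent a b G) z = (I * δ) • resolvent a b G z := by
  have hc := h.cubic hpos hβ z
  have hp : pd 1 (resolvent a b G) z = pd 1 (pd 1 (pd 1 G)) z +
      ((-(I * (a + b))) • pd 1 (pd 1 G) z + (-(a * b : ℂ)) • pd 1 G z) := by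
    have := pd_lincomb h.pd_one.pd_one.differentiable
      (h.pd_one.lincomb h (-(I * (a + b))) (-(a * b : ℂ))).differentiable 1 1 1 z
    rw [pd_lincomb h.pd_one.differentiable h.differentiable] at this
    simp only [one_smul] at this
    exact this
  rw [hp, hc, resolvent]
  have c1 : (δ : ℂ) + a + b = 0 := by exact_mod_cast congrArg ((↑) : ℝ → ℂ) e1
  have c2 : (δ : ℂ) * a + δ * b + a * b = -β := by exact_mod_cast congrArg ((↑) : ℝ → ℂ) e2
  have c3 : (δ : ℂ) * a * b = -(2 * ρ) := by exact_mod_cast congrArg ((↑) : ℝ → ℂ) e3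
  ext k
  simp only [Pi.add_apply, Pi.smul_apply, smul_eq_mul]
  linear_combination (-I * pd 1 (pd 1 G) z k) * c1 - pd 1 G z k * c2 + I * G z k * c3
    + (δ * (a + b) * pd 1 G z k) * I_mul_I

/-- Lagrange interpolation at the nodes `ia, ib, ic`; the minus signs come from `i² = -1`. -/
theorem resolvent_sum {a b c : ℝ} (hab : a ≠ b) (hac : a ≠ c) (hbc : b ≠ c) (z : ℂ) :
    G z = (-((a - b) * (a - c) : ℂ)⁻¹) • resolvent b c G z +
      (-((b - a) * (b - c) : ℂ)⁻¹) • resolvent a c G z +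
      (-((c - a) * (c - b) : ℂ)⁻¹) • resolvent a b G z := by
  have h1 : (a - b : ℂ) ≠ 0 := sub_ne_zero.mpr (ofReal_injective.ne hab)
  have h2 : (a - c : ℂ) ≠ 0 := sub_ne_zero.mpr (ofReal_injective.ne hac)
  have h3 : (b - c : ℂ) ≠ 0 := sub_ne_zero.mpr (ofReal_injective.ne hbc)
  have h4 : (b - a : ℂ) = -(a - b) := by ring
  have h5 : (c - a : ℂ) = -(a - c) := by ring
  have h6 : (c - b : ℂ) = -(b - c) := by ring
  ext k
  simp only [resolvent, Pi.add_apply, Pi.smul_apply, smul_eq_mul, h4, h5, h6]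
  field_simp
  ring

theorem resolvent_translate {a b : ℝ} (h : Differentiable ℝ G) (h' : Differentiable ℝ (pd 1 G))
    {τ c : ℂ} (hc : ∀ z, G (z + τ) = c • G z) (z : ℂ) :
    resolvent a b G (z + τ) = c • resolvent a b G z := by
  have e1 : ∀ {A : ℂ → C3}, Differentiable ℝ A → (∀ z, A (z + τ) = c • A z) →
      ∀ z, pd 1 A (z + τ) = c • pd 1 A z := by
    intro A hA hcA z
    rw [← pd_comp_add A, show (fun z => A (z + τ)) = fun z => c • A z from funext hcA]
    exact pd_eq_of_hasDerivAt (hA.const_smul c) ((hasDerivAt_line_zero hA 1 z).const_smul c)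
  rw [resolvent, resolvent, hc, e1 h hc, e1 h' (e1 h hc)]
  ext k
  simp only [Pi.add_apply, Pi.smul_apply, smul_eq_mul]
  ring

end StructureEquations
end

/-! ### From the lift to the linear system and its first integral. -/

noncomputable section

variable {F : ℂ → C3} {f : ℂ → CP2}

namespace IsMinimalLagrangianLift

theorem contDiff_hopf (hF : IsMinimalLagrangianLift F f) : ContDiff ℝ ∞ (hopf F) := by
  have hz : ∀ {A : ℂ → C3}, ContDiff ℝ ∞ A → ContDiff ℝ ∞ (dz A) := by
    intro A hA
    rw [show dz A = _ from funext (dz_eq A)]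
    exact ((MinLag.contDiff_pd hA 1).const_smul (1 / 2 : ℂ)).add
      ((MinLag.contDiff_pd hA I).const_smul (-I / 2))
  have hzb : ContDiff ℝ ∞ (dzbar F) := by
    rw [show dzbar F = _ from funext (dzbar_eq F)]
    exact ((hF.contDiff_pd 1).const_smul (1 / 2 : ℂ)).add
      ((hF.contDiff_pd I).const_smul (I / 2))
  exact contDiff_herm (hz (hz hF.smooth)) hzb

theorem pd_one_expU (hF : IsMinimalLagrangianLift F f) (he : IsTranslationallyEquivariant f)
    (z : ℂ) : pd 1 (expU F) z = 0 := by
  apply pd_eq_of_hasDerivAt hF.differentiable_expU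
  simp only [mul_one, hF.expU_add_real he]
  exact hasDerivAt_const _ _

/-- An equivariant minimal Lagrangian lift with imaginary Hopf coefficient solves the structure
equations, and its conformal factor has a first integral. -/
theorem structureEquations (hF : IsMinimalLagrangianLift F f) (he : IsTranslationallyEquivariant f)
    {r : ℂ → ℝ} (hr : ∀ z, hopf F z = -I * r z) :
    (∀ z, r z = r 0) ∧ (∀ z, expU F z = expU F (z.im * I)) ∧
    StructureEquations (fun y => expU F (y * I)) (fun y => pd I (expU F) (y * I)) (r 0) F ∧
    (∀ y : ℝ, HasDerivAt (fun y : ℝ => expU F (y * I)) (pd I (expU F) (y * I)) y) ∧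
    ∃ β : ℝ, (∀ y : ℝ, (pd I (expU F) (y * I)) ^ 2 / 4 + r 0 ^ 2 + 2 * expU F (y * I) ^ 3 =
        β * expU F (y * I) ^ 2) ∧
      ∀ y : ℝ, HasDerivAt (fun y : ℝ => pd I (expU F) (y * I))
        (4 * β * expU F (y * I) - 12 * expU F (y * I) ^ 2) y := by
  have hx := hF.pd_one_expU he
  have hdr : Differentiable ℝ r := by
    have : r = fun z => (I * hopf F z).re := by
      funext z; rw [hr, ← mul_assoc, mul_neg, I_mul_I]; simp
    rw [this]
    exact reCLM.differentiable.comp ((hF.contDiff_hopf.differentiable (by simp)).const_mul I)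
  have hcomp := hF.compatibility hx hr hdr
  have hr0 : ∀ z, r z = r 0 := fun z =>
    eq_of_pd_eq_zero hdr (fun z => (hcomp z).1) (fun z => (hcomp z).2.1) z 0
  have hV := eq_of_pd_one_eq_zero hF.differentiable_expU hx
  have hV₁ := eq_of_pd_one_eq_zero (hF.differentiable_pd_expU I) (fun z => by
    rw [pd_comm hF.contDiff_expU, show pd 1 (expU F) = fun _ => 0 from funext hx]
    simp [pd])
  have hd : ∀ y : ℝ, HasDerivAt (fun y : ℝ => expU F (y * I)) (pd I (expU F) (y * I)) y := by
    intro y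
    simpa using hasDerivAt_line hF.differentiable_expU I 0 y
  have hd₁ : ∀ y : ℝ, HasDerivAt (fun y : ℝ => pd I (expU F) (y * I))
      (pd I (pd I (expU F)) (y * I)) y := by
    intro y
    simpa using hasDerivAt_line (hF.differentiable_pd_expU I) I 0 y
  refine ⟨hr0, hV, ⟨hF.smooth, fun z => ?_, fun z => ?_, fun z => ?_⟩, hd, ?_⟩
  · have h := hF.structure_xx hx hr z
    have hw := hF.expU_ne_zero z
    rw [← hV, ← hV₁, ← hr0 z, h, smul_add, smul_add, smul_smul, smul_smul, smul_smul]
    have e1 : (expU F z : ℂ) * (-(I * r z) / expU F z) = -(I * r z) := by field_simp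
    have e2 : (expU F z : ℂ) * (-((pd I (expU F) z : ℝ) : ℂ) / (2 * expU F z)) =
        -(((pd I (expU F) z : ℝ) : ℂ) / 2) := by field_simp
    rw [e1, e2]
    module
  · have h := hF.structure_xy hx hr z
    have hw := hF.expU_ne_zero z
    rw [← hV, ← hV₁, ← hr0 z, h, smul_add, smul_smul, smul_smul]
    congr 2 <;> field_simp
  · rw [hF.laplace, ← hV, neg_smul]
  -- The quotient is the future constant `β`; its derivative vanishes by the Gauss equation.
  · have hE : ∀ y : ℝ, HasDerivAt (fun y : ℝ => ((pd I (expU F) (y * I)) ^ 2 / 4 + r 0 ^ 2 +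
        2 * expU F (y * I) ^ 3) / expU F (y * I) ^ 2) 0 y := by
      intro y
      have hne := (hF.immersion (y * I)).ne'
      have h := ((((hd₁ y).pow 2).div_const 4).add_const (r 0 ^ 2)).add (((hd y).pow 3).const_mul 2)
      refine (h.div ((hd y).pow 2) (pow_ne_zero 2 hne)).congr_deriv ?_
      have hc := (hcomp (y * I)).2.2
      rw [hr0] at hc
      simp only [Pi.add_apply, Pi.pow_apply]
      push_cast
      rw [div_eq_zero_iff]
      left
      linear_combination (expU F (y * I) * pd I (expU F) (y * I) / 2) * hc
    have hconst := is_const_of_deriv_eq_zero (fun y => (hE y).differentiableAt)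
      (fun y => (hE y).deriv)
    refine ⟨((pd I (expU F) ((0 : ℝ) * I)) ^ 2 / 4 + r 0 ^ 2 +
        2 * expU F ((0 : ℝ) * I) ^ 3) / expU F ((0 : ℝ) * I) ^ 2, ?_, ?_⟩
    · intro y
      rw [← hconst y 0, div_mul_cancel₀ _ (pow_ne_zero 2 (hF.immersion (y * I)).ne')]
    · intro y
      refine (hd₁ y).congr_deriv ?_
      have hne := (hF.immersion (y * I)).ne'
      have hc := (hcomp (y * I)).2.2
      rw [hr0] at hc
      rw [← hconst y 0]
      field_simp
      linear_combination hc

end IsMinimalLagrangianLift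

theorem zpow_translate {G : ℂ → C3} {τ ε : ℂ} (hε : ε ≠ 0) (h : ∀ z, G (z + τ) = ε • G z) (m : ℤ)
    (z : ℂ) : G (z + m * τ) = ε ^ m • G z := by
  induction m using Int.induction_on with
  | zero => simp
  | succ i ih =>
    push_cast at ih ⊢
    rw [show z + (i + 1) * τ = z + i * τ + τ by ring, h, ih, smul_smul, zpow_add_one₀ hε, mul_comm]
  | pred i ih =>
    push_cast at ih ⊢
    have := h (z + (-i - 1) * τ)
    rw [show z + (-i - 1) * τ + τ = z + -i * τ by ring, ih] at this
    rw [zpow_sub_one₀ hε, mul_comm (ε ^ _), mul_smul, this, smul_smul, inv_mul_cancel₀ hε, one_smul]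

/-- Where `v₁ ≠ 0`, `F_xx` has a nonzero `F_y` coefficient, which `F_x` and `F` cannot cancel. Thus
all three spectral components are nonzero at one common point. -/
theorem IsMinimalLagrangianLift.resolvent_ne_zero (hF : IsMinimalLagrangianLift F f)
    {v v₁ : ℝ → ℝ} {ρ : ℝ} (h : StructureEquations v v₁ ρ F) {y : ℝ} (hy : v₁ y ≠ 0) (a b : ℝ) :
    StructureEquations.resolvent a b F (y * I) ≠ 0 := by
  intro h0
  have hxx := h.xx (y * I)
  simp only [mul_I_im, ofReal_re] at hxx
  have hlin : (-(I * ρ) - v y * (I * (a + b))) • pd 1 F (y * I) + (-(v₁ y / 2) : ℂ) • pd I F (y * I)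
      + (-(2 * (v y : ℂ) ^ 2) - v y * (a * b)) • F (y * I) = 0 := by
    have : (v y : ℂ) • StructureEquations.resolvent a b F (y * I) = 0 := by rw [h0, smul_zero]
    rw [← this, StructureEquations.resolvent, smul_add, hxx]
    module
  have := (hF.frame_independent hlin).2.1
  rw [neg_eq_zero, div_eq_zero_iff] at this
  exact hy (ofReal_eq_zero.mp (this.resolve_right two_ne_zero))

end

/-! ### The period lattice in terms of the exponents `δ j`. -/

noncomputable section

variable {F : ℂ → C3} {f : ℂ → CP2}

/-- The numbers `i δ j` are the roots of `X ^ 3 + β X - 2 i ρ`, and they describe the period lattice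
of `f`. -/
structure PeriodData (F : ℂ → C3) (f : ℂ → CP2) (ρ β : ℝ) (δ : Fin 3 → ℝ) : Prop where
  ne_zero : ∀ j, δ j ≠ 0
  ne01 : δ 0 ≠ δ 1
  ne02 : δ 0 ≠ δ 2
  ne12 : δ 1 ≠ δ 2
  e₁ : δ 0 + δ 1 + δ 2 = 0
  e₂ : δ 0 * δ 1 + δ 0 * δ 2 + δ 1 * δ 2 = -β
  e₃ : δ 0 * δ 1 * δ 2 = -(2 * ρ)
  halfPeriod_ne_zero : halfPeriod F ≠ 0
  mem_iff : ∀ τ : ℂ, τ ∈ periodLattice f ↔ ∃ m : ℤ, τ.im = m * (2 * halfPeriod F) ∧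
    ∃ c : ℂ, Complex.exp (I * δ 0 * τ.re) * (-1) ^ m = c ∧
      Complex.exp (I * δ 1 * τ.re) * (-1) ^ m = c ∧ Complex.exp (I * δ 2 * τ.re) = c

theorem StructureEquations.eigen_translate {v v₁ : ℝ → ℝ} {ρ δ T : ℝ} {G : ℂ → C3} {ε : ℂ}
    (h : StructureEquations v v₁ ρ G) (hδ : ∀ z, pd 1 G z = (I * δ) • G z) (hε : ε ≠ 0)
    (hT : ∀ z, G (z + 2 * T * I) = ε • G z) {τ : ℂ} {m : ℤ} (hm : τ.im = m * (2 * T)) (z : ℂ) :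
    G (z + τ) = (Complex.exp (I * δ * τ.re) * ε ^ m) • G z := by
  have hτ : z + τ = z + m * (2 * T * I) + τ.re := by
    conv_lhs => rw [← re_add_im τ, hm]
    push_cast; ring
  rw [hτ, h.eigen_translate_real hδ, zpow_translate hε hT, smul_smul]

/-- About the maximum and the minimum of `v` respectively, the component of `ρ/A₁` is odd and even,
that of `ρ/A₂` even and odd, that of `-ρ/A₃` even and even. Hence the signs `-1, -1, 1` under
translation by `2Ti`, and the ordering of `δ`. -/
theorem IsMinimalLagrangianLift.exists_periodData (hF : IsMinimalLagrangianLift F f) {ρ β : ℝ}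
    (hρ : ρ ≠ 0) (hhopf : hopf F 0 = -I * ρ)
    (hV : ∀ z, expU F z = expU F (z.im * I))
    (hS : StructureEquations (fun y => expU F (y * I)) (fun y => pd I (expU F) (y * I)) ρ F)
    (hd : ∀ y : ℝ, HasDerivAt (fun y : ℝ => expU F (y * I)) (pd I (expU F) (y * I)) y)
    (hβ : ∀ y : ℝ, (pd I (expU F) (y * I)) ^ 2 / 4 + ρ ^ 2 + 2 * expU F (y * I) ^ 3 =
        β * expU F (y * I) ^ 2)
    (hd₁ : ∀ y : ℝ, HasDerivAt (fun y : ℝ => pd I (expU F) (y * I))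
        (4 * β * expU F (y * I) - 12 * expU F (y * I) ^ 2) y)
    (hnc : ∃ z w, expU F z ≠ expU F w) : ∃ δ, PeriodData F f ρ β δ := by
  set v : ℝ → ℝ := fun y => expU F (y * I) with hv
  set v₁ : ℝ → ℝ := fun y => pd I (expU F) (y * I) with hv₁
  have hpos : ∀ y, 0 < v y := fun y => hF.immersion _
  have hβ' : ∀ y, v₁ y ^ 2 / 4 + ρ ^ 2 + 2 * v y ^ 3 = β * v y ^ 2 := hβ
  have hcont : Continuous v := continuous_iff_continuousAt.mpr fun y => (hd y).continuousAt
  obtain ⟨y₁, hy₁⟩ : ∃ y, v₁ y ≠ 0 := by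
    by_contra! h0
    obtain ⟨z, w, hzw⟩ := hnc
    apply hzw
    rw [hV z, hV w]
    exact is_const_of_deriv_eq_zero (fun y => (hd y).differentiableAt)
      (fun y => (hd y).deriv.trans (h0 y)) z.im w.im
  -- By the first integral the cubic takes the value `-v₁²/8` along `v`, which is negative at `y₁`.
  obtain ⟨A₁, A₂, A₃, h2, h21, h3, hrel, hβA, hρA, hA₂, hA₃⟩ :=
    exists_cubic_roots (β := β) hρ (hpos y₁) (by
      have := hβ' y₁
      have : 0 < v₁ y₁ ^ 2 := by positivity
      linarith)
  have h1 : 0 < A₁ := h2.trans h21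
  have hen : ∀ y, v₁ y ^ 2 = 8 * (A₁ - v y) * (v y - A₂) * (v y + A₃) := by
    intro y
    have := hβ' y
    rw [hβA, hρA] at this
    linear_combination 4 * this + (8 * v y) * hrel
  obtain ⟨y₀, hmax, hmin, hsym₀, hsym₁, hper, hle⟩ := exists_profile h2 h21 h3 hrel hd
    (fun y => (hd₁ y).congr_deriv (by rw [hβA]; ring)) hen hpos rfl
  have ea₁ : a₁ F = A₁ := by
    have hle' : ∀ z, expU F z ≤ A₁ := fun z => by rw [hV]; exact hle z.im
    refine le_antisymm (ciSup_le hle') ?_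
    rw [← hmax]
    exact le_ciSup (f := expU F) ⟨A₁, by rintro _ ⟨z, rfl⟩; exact hle' z⟩ (y₀ * I)
  have eδ : delta F = ρ ^ 2 / (2 * A₁ ^ 2) := by
    rw [delta, ea₁, hhopf]
    simp
  have ea₂ : a₂ F = A₂ := by rw [a₂, eδ, ea₁, ← hA₂]
  have ea₃ : a₃ F = A₃ := by rw [a₃, eδ, ea₁, ← hA₃]
  have eT : halfPeriod F = ellipticK √((A₁ - A₂) / (A₁ + A₃)) / √(2 * (A₁ + A₃)) := by
    rw [halfPeriod, ea₁, ea₂, ea₃]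
  rw [← eT] at hmin hsym₁ hper
  set T := halfPeriod F with hT
  have hc₀ : v₁ y₀ = 0 := by
    have := hen y₀
    rw [hmax, sub_self, mul_zero, zero_mul, zero_mul] at this
    exact pow_eq_zero_iff two_ne_zero |>.mp this
  have hc₁ : v₁ (y₀ + T) = 0 := by
    have := hen (y₀ + T)
    rw [hmin, sub_self, mul_zero, zero_mul] at this
    exact pow_eq_zero_iff two_ne_zero |>.mp this
  -- The substitution `δ = ρ / w` carries `w³ - (β/2)w² + ρ²/2` to `δ³ - βδ + 2ρ`; `ea`, `eb`, `ec`
  -- are the Vieta relations of the latter.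
  have ea : ρ / A₁ + ρ / A₂ + -ρ / A₃ = 0 := by
    field_simp; linear_combination -ρ * hrel
  have eb : ρ / A₁ * (ρ / A₂) + ρ / A₁ * (-ρ / A₃) + ρ / A₂ * (-ρ / A₃) = -β := by
    rw [hβA]; field_simp; rw [hρA]; ring
  have ec : ρ / A₁ * (ρ / A₂) * (-ρ / A₃) = -(2 * ρ) := by
    field_simp; rw [hρA]; ring
  have n01 : ρ / A₁ ≠ ρ / A₂ := by
    rw [Ne, div_eq_div_iff h1.ne' h2.ne']
    intro h; exact h21.ne (mul_left_cancel₀ hρ h)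
  have n02 : ρ / A₁ ≠ -ρ / A₃ := by
    rw [Ne, div_eq_div_iff h1.ne' h3.ne']
    intro h
    have : ρ * (A₃ + A₁) = 0 := by linear_combination h
    rcases mul_eq_zero.mp this with h | h
    · exact hρ h
    · linarith
  have n12 : ρ / A₂ ≠ -ρ / A₃ := by
    rw [Ne, div_eq_div_iff h2.ne' h3.ne']
    intro h
    have : ρ * (A₃ + A₂) = 0 := by linear_combination h
    rcases mul_eq_zero.mp this with h | h
    · exact hρ h
    · linarith
  set δ₁ := ρ / A₁ with hδ₁
  set δ₂ := ρ / A₂ with hδ₂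
  set δ₃ := -ρ / A₃ with hδ₃
  have hv₁A : A₁ * δ₁ = ρ := by rw [hδ₁]; field_simp
  have hv₂A : A₂ * δ₂ = ρ := by rw [hδ₂]; field_simp
  have hv₃A : A₃ * δ₃ = -ρ := by rw [hδ₃]; field_simp
  have S1 := hS.resolvent_structure δ₂ δ₃
  have S2 := hS.resolvent_structure δ₁ δ₃
  have S3 := hS.resolvent_structure δ₁ δ₂
  have E1 := hS.resolvent_eigen hpos hβ' (δ := δ₁) ea (by linarith) ec
  have E2 := hS.resolvent_eigen hpos hβ' (δ := δ₂) (a := δ₁) (b := δ₃) (by linarith) (by linarith)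
    (by linarith)
  have E3 := hS.resolvent_eigen hpos hβ' (δ := δ₃) (a := δ₁) (b := δ₂) (by linarith) (by linarith)
    (by linarith)
  have N := fun a b => hF.resolvent_ne_zero hS hy₁ a b
  have q12 : A₂ * δ₁ ≠ ρ := fun h => by
    have : (A₂ - A₁) * δ₁ = 0 := by linear_combination h - hv₁A
    rcases mul_eq_zero.mp this with h' | h'
    · linarith
    · rw [h', mul_zero] at h; exact hρ h.symm
  have q21 : A₁ * δ₂ ≠ ρ := fun h => by
    have : (A₁ - A₂) * δ₂ = 0 := by linear_combination h - hv₂A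
    rcases mul_eq_zero.mp this with h' | h'
    · linarith
    · rw [h', mul_zero] at h; exact hρ h.symm
  have q3 : ∀ A, 0 < A → A * δ₃ ≠ ρ := fun A hA h => by
    have : (A + A₃) * δ₃ = 0 := by linear_combination h + hv₃A
    rcases mul_eq_zero.mp this with h' | h'
    · linarith
    · rw [h', mul_zero] at h; exact hρ h.symm
  -- From `A₃ = A₁A₂/(A₁ + A₂)` one gets `A₂/2 < A₃ < A₁/2`. Both inequalities keep the odd-parity
  -- coefficients `2(ρ² - A³)/A`, with `ρ² = 2A₁A₂A₃`, away from zero.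
  have hA₃lt : 2 * (A₂ * A₃) < A₁ ^ 2 := by
    nlinarith [mul_pos h1 h2, mul_pos h1 h3, mul_pos h2 h3]
  have hA₃gt : A₂ ^ 2 < 2 * (A₁ * A₃) := by
    nlinarith [mul_pos h1 h2, mul_pos h1 h3, mul_pos h2 h3]
  have o1 : A₁ * δ₁ ^ 2 + ρ * δ₁ - 2 * A₁ ^ 2 ≠ 0 := by
    intro h
    have h' : A₁ * (A₁ * δ₁ ^ 2 + ρ * δ₁ - 2 * A₁ ^ 2) = 2 * (ρ ^ 2 - A₁ ^ 3) := by
      linear_combination (A₁ * δ₁ + ρ + ρ) * hv₁A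
    rw [h, mul_zero, hρA] at h'
    have : A₁ * (2 * (A₂ * A₃) - A₁ ^ 2) = 0 := by linear_combination (-1 / 2) * h'
    rcases mul_eq_zero.mp this with h | h <;> linarith
  have o2 : A₂ * δ₂ ^ 2 + ρ * δ₂ - 2 * A₂ ^ 2 ≠ 0 := by
    intro h
    have h' : A₂ * (A₂ * δ₂ ^ 2 + ρ * δ₂ - 2 * A₂ ^ 2) = 2 * (ρ ^ 2 - A₂ ^ 3) := by
      linear_combination (A₂ * δ₂ + ρ + ρ) * hv₂A
    rw [h, mul_zero, hρA] at h'
    have : A₂ * (2 * (A₁ * A₃) - A₂ ^ 2) = 0 := by linear_combination (-1 / 2) * h'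
    rcases mul_eq_zero.mp this with h | h <;> linarith
  have T1 := S1.eigen_translate_imag E1 (y₀ := y₀) (T := T) (a := -1) (b := 1)
    (fun s => by
      rw [neg_one_smul]; exact S1.eigen_odd E1 hcont hsym₀ hc₀ (by rwa [hmax]) s)
    (fun s => by
      rw [one_smul]
      exact S1.eigen_even E1 hcont hsym₁ hc₁ (by rw [hmin]; exact sub_ne_zero.mpr q12) s)
  have T2 := S2.eigen_translate_imag E2 (y₀ := y₀) (T := T) (a := 1) (b := -1)
    (fun s => by
      rw [one_smul]
      exact S2.eigen_even E2 hcont hsym₀ hc₀ (by rw [hmax]; exact sub_ne_zero.mpr q21) s)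
    (fun s => by
      rw [neg_one_smul]; exact S2.eigen_odd E2 hcont hsym₁ hc₁ (by rwa [hmin]) s)
  have T3 := S3.eigen_translate_imag E3 (y₀ := y₀) (T := T) (a := 1) (b := 1)
    (fun s => by
      rw [one_smul]
      exact S3.eigen_even E3 hcont hsym₀ hc₀ (by rw [hmax]; exact sub_ne_zero.mpr (q3 _ h1)) s)
    (fun s => by
      rw [one_smul]
      exact S3.eigen_even E3 hcont hsym₁ hc₁ (by rw [hmin]; exact sub_ne_zero.mpr (q3 _ h2)) s)
  rw [mul_one] at T1
  rw [one_mul] at T2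
  rw [one_mul] at T3
  have hne1 : (-1 : ℂ) ≠ 0 := by norm_num
  refine ⟨![δ₁, δ₂, δ₃], ?_, n01, n02, n12, ea, eb, ec, ?_, fun τ => ?_⟩
  · intro j
    fin_cases j
    · exact div_ne_zero hρ h1.ne'
    · exact div_ne_zero hρ h2.ne'
    · exact div_ne_zero (neg_ne_zero.mpr hρ) h3.ne'
  · intro h0
    rw [← hT] at h0
    rw [h0, add_zero, hmax] at hmin
    linarith
  · change _ ↔ ∃ m : ℤ, τ.im = m * (2 * T) ∧ ∃ c : ℂ, Complex.exp (I * δ₁ * τ.re) * (-1) ^ m = c ∧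
      Complex.exp (I * δ₂ * τ.re) * (-1) ^ m = c ∧ Complex.exp (I * δ₃ * τ.re) = c
    have dF := hS.differentiable
    have dF' := hS.pd_one.differentiable
    constructor
    · intro hτ
      obtain ⟨c, hc⟩ := (hF.mem_periodLattice_iff τ).mp hτ
      -- A period carries the maximum of `v` at `y₀` to a maximum, and these occur only at `y₀ +
      -- 2Tℤ`.
      have hv := hF.expU_period hτ (y₀ * I)
      rw [hV] at hv
      simp only [add_im, mul_I_im, ofReal_re] at hv
      obtain ⟨m, hm⟩ := hper τ.im (hv.trans hmax)
      -- At `y₁ * I` no component vanishes, so each multiplier must equal the common phase `c`.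
      have k1 := S1.eigen_translate E1 hne1 T1 hm (y₁ * I)
      have k2 := S2.eigen_translate E2 hne1 T2 hm (y₁ * I)
      have k3 := S3.eigen_translate E3 one_ne_zero T3 hm (y₁ * I)
      rw [StructureEquations.resolvent_translate dF dF' hc] at k1 k2 k3
      refine ⟨m, hm, c, ?_, ?_, ?_⟩
      · exact (smul_left_injective ℂ (N _ _) k1).symm
      · exact (smul_left_injective ℂ (N _ _) k2).symm
      · have := smul_left_injective ℂ (N _ _) k3
        rw [one_zpow, mul_one] at this
        exact this.symm
    · rintro ⟨m, hm, c, c1, c2, c3⟩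
      refine (hF.mem_periodLattice_iff τ).mpr ⟨c, fun z => ?_⟩
      rw [StructureEquations.resolvent_sum (G := F) n01 n02 n12 (z + τ),
        StructureEquations.resolvent_sum (G := F) n01 n02 n12 z,
        S1.eigen_translate E1 hne1 T1 hm, S2.eigen_translate E2 hne1 T2 hm,
        S3.eigen_translate E3 one_ne_zero T3 hm, c1, c2, one_zpow, mul_one, c3]
      module

end

/-! ### The characteristic polynomial of the generator. -/

noncomputable section

section Generator

open Polynomial in
theorem charpoly_fin_three (a b c d e g h k l : ℂ) :
    (!![a, b, c; d, e, g; h, k, l] : Matrix (Fin 3) (Fin 3) ℂ).charpoly =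
      X ^ 3 - C (a + e + l) * X ^ 2 +
        C (a * e - b * d + (a * l - c * h) + (e * l - g * k)) * X -
        C (a * e * l - a * g * k - b * d * l + b * g * h + c * d * k - c * e * h) := by
  simp [Matrix.charpoly, Matrix.det_fin_three]
  ring

variable {F : ℂ → C3} {f : ℂ → CP2}

-- Identifies the eigenvalues of `D` with the exponents of `F` along `x`. The column factors `c₁`,
-- `c₂` are constant along `x` and act by a diagonal conjugation, so `lam` does not enter the
-- result.
open Polynomial in
theorem IsMinimalLagrangianLift.charpoly_generator (hF : IsMinimalLagrangianLift F f)
    (he : IsTranslationallyEquivariant f) {r : ℂ → ℝ} (hr : ∀ z, hopf F z = -I * r z) {β : ℝ}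
    (hβ : (pd I (expU F) 0) ^ 2 / 4 + r 0 ^ 2 + 2 * expU F 0 ^ 3 = β * expU F 0 ^ 2)
    {lam : ℂ} (hlam : ‖lam‖ = 1) :
    (generator F lam).charpoly = X ^ 3 + C (β : ℂ) * X - C (2 * I * r 0) := by
  have hx := hF.pd_one_expU he
  have hw : (expU F 0 : ℂ) ≠ 0 := hF.expU_ne_zero 0
  have hl : lam ≠ 0 := by rintro rfl; simp at hlam
  set s : ℂ := (Real.exp (-(metricU F 0) / 2) : ℂ) with hs
  have hs0 : s ≠ 0 := ofReal_ne_zero.mpr (Real.exp_pos _).ne'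
  set c₁ : ℂ := -I * lam * s with hc₁
  set c₂ : ℂ := (I * lam)⁻¹ * s with hc₂
  have hc₁0 : c₁ ≠ 0 := by simp [hc₁, hl, hs0]
  have hc₂0 : c₂ ≠ 0 := by simp [hc₂, hl, hs0]
  have hmetric : ∀ x : ℝ, metricU F (x : ℂ) = metricU F 0 := by
    intro x
    have := hF.expU_add_real he 0 x
    rw [zero_add] at this
    rw [metricU, this, metricU]
  have hE : ∀ x : ℝ, extendedFrame F lam (x : ℂ) =
      Matrix.of fun j => ![c₁ * dz F x j, c₂ * dzbar F x j, F x j] := by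
    intro x
    rw [extendedFrame, hmetric]
  have hE0 := hE 0
  rw [ofReal_zero] at hE0
  have hddz : Differentiable ℝ (dz F) := by
    rw [show dz F = _ from funext (dz_eq F)]
    exact ((hF.differentiable_pd 1).const_smul (1 / 2 : ℂ)).add
      ((hF.differentiable_pd I).const_smul (-I / 2))
  have hddzbar : Differentiable ℝ (dzbar F) := by
    rw [show dzbar F = _ from funext (dzbar_eq F)]
    exact ((hF.differentiable_pd 1).const_smul (1 / 2 : ℂ)).add
      ((hF.differentiable_pd I).const_smul (I / 2))
  have hline : ∀ {A : ℂ → C3}, Differentiable ℝ A → ∀ i,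
      HasDerivAt (fun x : ℝ => A (x : ℂ) i) (pd 1 A 0 i) 0 := by
    intro A hA i
    have := hasDerivAt_line_zero hA 1 0
    simp only [zero_add, mul_one] at this
    exact hasDerivAt_pi.mp this i
  have hEx : (Matrix.of fun i j => deriv (fun x : ℝ => extendedFrame F lam (x : ℂ) i j) 0) =
      Matrix.of fun i => ![c₁ * pd 1 (dz F) 0 i, c₂ * pd 1 (dzbar F) 0 i, pd 1 F 0 i] := by
    ext i j
    simp only [hE, Matrix.of_apply]
    fin_cases j
    · exact ((hline hddz i).const_mul c₁).deriv
    · exact ((hline hddzbar i).const_mul c₂).deriv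
    · exact (hline hF.differentiable i).deriv
  have hdet : IsUnit (extendedFrame F lam 0).det := by
    rw [isUnit_iff_ne_zero]
    intro h0
    obtain ⟨x, hx0, hx⟩ := Matrix.exists_mulVec_eq_zero_iff.mpr h0
    apply hx0
    have hlin : ((c₁ * x 0 + c₂ * x 1) / 2) • pd 1 F 0 + (I * (c₂ * x 1 - c₁ * x 0) / 2) • pd I F 0
        + x 2 • F 0 = 0 := by
      ext k
      have hk := congrFun hx k
      rw [hE0] at hk
      simp only [Matrix.mulVec, dotProduct, Matrix.of_apply, Fin.sum_univ_three, dz_eq, dzbar_eq,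
        Matrix.cons_val_zero, Matrix.cons_val_one, Matrix.cons_val, Pi.add_apply, Pi.smul_apply,
        smul_eq_mul, Pi.zero_apply] at hk ⊢
      linear_combination hk
    obtain ⟨e1, e2, e3⟩ := hF.frame_independent hlin
    have e4 : c₂ * x 1 - c₁ * x 0 = 0 := by
      have : I * (c₂ * x 1 - c₁ * x 0) = 0 := by linear_combination 2 * e2
      exact (mul_eq_zero.mp this).resolve_left I_ne_zero
    ext j
    fin_cases j
    · have : c₁ * x 0 = 0 := by linear_combination e1 - e4 / 2
      exact (mul_eq_zero.mp this).resolve_left hc₁0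
    · have : c₂ * x 1 = 0 := by linear_combination e1 + e4 / 2
      exact (mul_eq_zero.mp this).resolve_left hc₂0
    · exact e3
  set w : ℂ := (expU F 0 : ℂ) with hwdef
  set w₁ : ℂ := ((pd I (expU F) 0 : ℝ) : ℂ) with hw₁def
  set ρ : ℂ := (r 0 : ℂ) with hρdef
  have hb : w₁ ^ 2 / 4 + ρ ^ 2 + 2 * w ^ 3 = β * w ^ 2 := by
    rw [hwdef, hw₁def, hρdef]
    exact_mod_cast hβ
  have hxx := hF.structure_xx hx hr 0
  have hxy := hF.structure_xy hx hr 0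
  rw [← hwdef, ← hw₁def, ← hρdef] at hxx
  rw [← hwdef, ← hw₁def, ← hρdef] at hxy
  clear_value w w₁ ρ
  have hPx : pd 1 (dz F) 0 = (-(I * w₁ / (2 * w))) • dz F 0 + (-(I * ρ / w)) • dzbar F 0
      + (-w) • F 0 := by
    rw [hF.pd_dz, hxx, hxy, dz_eq, dzbar_eq]
    ext k
    simp only [Pi.add_apply, Pi.smul_apply, smul_eq_mul]
    linear_combination (-(w₁ / (4 * w)) * pd I F 0 k) * I_mul_I
  have hQx : pd 1 (dzbar F) 0 = (-(I * ρ / w)) • dz F 0 + (I * w₁ / (2 * w)) • dzbar F 0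
      + (-w) • F 0 := by
    have h1 : pd 1 (dzbar F) 0 = (1 / 2 : ℂ) • pd 1 (pd 1 F) 0 + (I / 2) • pd 1 (pd I F) 0 := by
      rw [← pd_lincomb (hF.differentiable_pd 1) (hF.differentiable_pd I), ← funext (dzbar_eq F)]
    rw [h1, hxx, hxy, dz_eq, dzbar_eq]
    ext k
    simp only [Pi.add_apply, Pi.smul_apply, smul_eq_mul]
    linear_combination (-(w₁ / (4 * w)) * pd I F 0 k) * I_mul_I
  have hD : generator F lam = !![-(I * w₁ / (2 * w)), -(I * ρ / w) * c₂ / c₁, 1 / c₁;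
      -(I * ρ / w) * c₁ / c₂, I * w₁ / (2 * w), 1 / c₂; -w * c₁, -w * c₂, 0] := by
    rw [generator, hEx]
    have hmul : (Matrix.of fun i => ![c₁ * pd 1 (dz F) 0 i, c₂ * pd 1 (dzbar F) 0 i, pd 1 F 0 i]) =
        extendedFrame F lam 0 * !![-(I * w₁ / (2 * w)), -(I * ρ / w) * c₂ / c₁, 1 / c₁;
      -(I * ρ / w) * c₁ / c₂, I * w₁ / (2 * w), 1 / c₂; -w * c₁, -w * c₂, 0] := by
      rw [hE0, hPx, hQx, pd_one_eq]
      ext i j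
      fin_cases j <;> simp [Matrix.mul_apply, Fin.sum_univ_three] <;> field_simp
    rw [hmul, Matrix.nonsing_inv_mul_cancel_left _ _ hdet]
  rw [hD, charpoly_fin_three]
  have t1 : -(I * w₁ / (2 * w)) + I * w₁ / (2 * w) + 0 = 0 := by ring
  have t2 : -(I * w₁ / (2 * w)) * (I * w₁ / (2 * w)) -
      -(I * ρ / w) * c₂ / c₁ * (-(I * ρ / w) * c₁ / c₂) +
      (-(I * w₁ / (2 * w)) * 0 - 1 / c₁ * (-w * c₁)) +
      (I * w₁ / (2 * w) * 0 - 1 / c₂ * (-w * c₂)) = β := by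
    field_simp
    linear_combination 4 * hb - (w₁ ^ 2 + 4 * ρ ^ 2) * I_mul_I
  have t3 : -(I * w₁ / (2 * w)) * (I * w₁ / (2 * w)) * 0 -
      -(I * w₁ / (2 * w)) * (1 / c₂) * (-w * c₂) -
      -(I * ρ / w) * c₂ / c₁ * (-(I * ρ / w) * c₁ / c₂) * 0 +
      -(I * ρ / w) * c₂ / c₁ * (1 / c₂) * (-w * c₁) +
      1 / c₁ * (-(I * ρ / w) * c₁ / c₂) * (-w * c₂) -
      1 / c₁ * (I * w₁ / (2 * w)) * (-w * c₁) = 2 * I * ρ := by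
    field_simp
    ring
  rw [t1, t2, t3, C_0, zero_mul, sub_zero]

end Generator
end

/-! ### Shape of the lattice and the rationality criterion. -/

noncomputable section

namespace PeriodData

variable {F : ℂ → C3} {f : ℂ → CP2} {ρ β : ℝ} {δ : Fin 3 → ℝ}

/-- The real periods of `f`. -/
def realPeriods (f : ℂ → CP2) : AddSubgroup ℝ :=
  (periodLattice f).comap ofRealHom.toAddMonoidHom

theorem mem_realPeriods (x : ℝ) : x ∈ realPeriods f ↔ (x : ℂ) ∈ periodLattice f := Iff.rfl

section
variable (h : PeriodData F f ρ β δ)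
include h

theorem ofReal_mem_iff (x : ℝ) : (x : ℂ) ∈ periodLattice f ↔
    ∃ c : ℂ, ∀ j, Complex.exp (I * δ j * x) = c := by
  rw [h.mem_iff]
  constructor
  · rintro ⟨m, hm, c, c1, c2, c3⟩
    have hm0 : m = 0 := by
      rw [ofReal_im] at hm
      rcases mul_eq_zero.mp hm.symm with h' | h'
      · exact_mod_cast h'
      · exact absurd h' (mul_ne_zero two_ne_zero h.halfPeriod_ne_zero)
    rw [hm0, zpow_zero, mul_one, ofReal_re] at c1 c2
    rw [ofReal_re] at c3
    refine ⟨c, fun j => ?_⟩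
    fin_cases j
    exacts [c1, c2, c3]
  · rintro ⟨c, hc⟩
    exact ⟨0, by simp, c, by simpa using hc 0, by simpa using hc 1, by simpa using hc 2⟩

theorem four_mem : (4 * (halfPeriod F : ℂ) * I) ∈ periodLattice f := by
  rw [h.mem_iff]
  refine ⟨2, ?_, 1, ?_, ?_, ?_⟩
  · simp; ring
  all_goals simp

theorem two_notMem : (2 * (halfPeriod F : ℂ) * I) ∉ periodLattice f := by
  rw [h.mem_iff]
  rintro ⟨m, hm, c, c1, -, c3⟩
  have hm1 : m = 1 := by
    have : ((m : ℝ) - 1) * (2 * halfPeriod F) = 0 := by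
      simp at hm
      linear_combination -hm
    rcases mul_eq_zero.mp this with h' | h'
    · have : (m : ℝ) = 1 := by linarith
      exact_mod_cast this
    · exact absurd h' (mul_ne_zero two_ne_zero h.halfPeriod_ne_zero)
  rw [← c3, hm1] at c1
  norm_num at c1

/-- Equality of the first two exponentials puts `(δ 0 - δ 1) x` in `2πℤ`. The resulting gap makes
the real periods cyclic. -/
theorem disjoint_realPeriods : ∃ a : ℝ, 0 < a ∧
    Disjoint (realPeriods f : Set ℝ) (Set.Ioo 0 a) := by
  have hδ : 0 < |δ 0 - δ 1| := abs_pos.mpr (sub_ne_zero.mpr h.ne01)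
  refine ⟨2 * Real.pi / |δ 0 - δ 1|, by positivity, ?_⟩
  rw [Set.disjoint_left]
  rintro x hx ⟨hx0, hxa⟩
  obtain ⟨c, hc⟩ := (h.ofReal_mem_iff x).mp hx
  obtain ⟨n, hn⟩ := Complex.exp_eq_exp_iff_exists_int.mp ((hc 0).trans (hc 1).symm)
  have hre : (δ 0 - δ 1) * x = n * (2 * Real.pi) := by
    have : I * (((δ 0 - δ 1) * x : ℝ) : ℂ) = I * ((n * (2 * Real.pi) : ℝ) : ℂ) := by
      push_cast; linear_combination hn
    exact ofReal_injective (mul_left_cancel₀ I_ne_zero this)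
  have habs : |δ 0 - δ 1| * x = |(n : ℝ)| * (2 * Real.pi) := by
    have := congrArg abs hre
    rwa [abs_mul, abs_mul, abs_of_pos hx0, abs_of_pos Real.two_pi_pos] at this
  rw [lt_div_iff₀ hδ, mul_comm, habs] at hxa
  have hn0 : |(n : ℝ)| < 1 := by
    by_contra! hge
    have := mul_le_mul_of_nonneg_right hge Real.two_pi_pos.le
    linarith
  have hn1 : n = 0 := by
    have : |n| < 1 := by exact_mod_cast hn0
    exact Int.abs_lt_one_iff.mp this
  rw [hn1, Int.cast_zero, abs_zero, zero_mul] at habs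
  exact (mul_pos hδ hx0).ne' habs

theorem lattice_eq (hne : realPeriods f ≠ ⊥) :
    ∃ p : ℝ, IsLeast {t : ℝ | 0 < t ∧ (t : ℂ) ∈ periodLattice f} p ∧
      (periodLattice f = AddSubgroup.zmultiples (p : ℂ) ⊔
          AddSubgroup.zmultiples (4 * (halfPeriod F : ℂ) * I) ∨
        periodLattice f = AddSubgroup.zmultiples (p : ℂ) ⊔
          AddSubgroup.zmultiples ((p : ℂ) / 2 + 2 * (halfPeriod F : ℂ) * I)) := by
  obtain ⟨a, ha, hdisj⟩ := h.disjoint_realPeriods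
  obtain ⟨p, hp⟩ := AddSubgroup.exists_isLeast_pos hne ha hdisj
  have hcyc := AddSubgroup.cyclic_of_min hp
  have hpL : (p : ℂ) ∈ periodLattice f := hp.1.1
  have hreal : ∀ x : ℝ, (x : ℂ) ∈ periodLattice f → ∃ k : ℤ, k • (p : ℂ) = x := by
    intro x hx
    have hx' : x ∈ realPeriods f := hx
    rw [hcyc, ← AddSubgroup.zmultiples_eq_closure, AddSubgroup.mem_zmultiples_iff] at hx'
    obtain ⟨k, rfl⟩ := hx'
    exact ⟨k, by simp⟩
  refine ⟨p, ⟨⟨hp.1.2, hp.1.1⟩, fun t ht => hp.2 ⟨ht.2, ht.1⟩⟩, ?_⟩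
  have hle : ∀ g ∈ periodLattice f,
      AddSubgroup.zmultiples (p : ℂ) ⊔ AddSubgroup.zmultiples g ≤ periodLattice f := by
    intro g hg
    rw [sup_le_iff, AddSubgroup.zmultiples_le, AddSubgroup.zmultiples_le]
    exact ⟨hpL, hg⟩
  -- If the imaginary part of every period is an integer multiple of `g.im`, subtracting multiples
  -- of `g` reduces to real periods, which `p` generates.
  have hge : ∀ g ∈ periodLattice f, (∀ τ ∈ periodLattice f, ∃ n : ℤ, τ.im = n * g.im) →
      periodLattice f = AddSubgroup.zmultiples (p : ℂ) ⊔ AddSubgroup.zmultiples g := by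
    intro g hg hn
    refine le_antisymm (fun τ hτ => ?_) (hle g hg)
    obtain ⟨n, hn⟩ := hn τ hτ
    have hmem : τ - n • g ∈ periodLattice f := sub_mem hτ (zsmul_mem hg n)
    have hre : τ - n • g = (((τ - n • g).re : ℝ) : ℂ) := by
      apply Complex.ext
      · simp
      · simp [hn]
    rw [hre] at hmem
    obtain ⟨k, hk⟩ := hreal _ hmem
    rw [← hre] at hk
    rw [AddSubgroup.mem_sup]
    exact ⟨k • (p : ℂ), AddSubgroup.mem_zmultiples_iff.mpr ⟨k, rfl⟩, n • g,
      AddSubgroup.mem_zmultiples_iff.mpr ⟨n, rfl⟩, by rw [hk]; abel⟩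
  -- The two lattices are told apart by whether some period has imaginary part an odd multiple of
  -- `2T`.
  by_cases hodd : ∃ τ ∈ periodLattice f, ∃ n : ℤ, τ.im = (2 * n + 1 : ℤ) * (2 * halfPeriod F)
  · right
    obtain ⟨τ, hτ, n, hn⟩ := hodd
    set σ := τ - n • (4 * (halfPeriod F : ℂ) * I) with hσdef
    have hσ : σ ∈ periodLattice f := sub_mem hτ (zsmul_mem h.four_mem n)
    have hσeq : σ = σ.re + 2 * (halfPeriod F : ℂ) * I := by
      apply Complex.ext
      · simp
      · rw [hσdef]
        push_cast at hn
        simp [hn]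
        ring
    have h2 : ((2 * σ.re : ℝ) : ℂ) ∈ periodLattice f := by
      have := sub_mem (add_mem hσ hσ) h.four_mem
      convert this using 1
      conv_rhs => rw [hσeq]
      push_cast; ring
    obtain ⟨k, hk⟩ := hreal _ h2
    rw [zsmul_eq_mul] at hk
    push_cast at hk
    -- Here `2 Re σ = k p`. An even `k` would make `2Ti` a period; an odd `k` moves `σ` to `p/2 +
    -- 2Ti` by a multiple of `p`.
    rcases Int.even_or_odd' k with ⟨j, rfl | rfl⟩
    · exfalso
      apply h.two_notMem
      have := sub_mem hσ (zsmul_mem hpL j)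
      convert this using 1
      conv_rhs => rw [hσeq]
      push_cast at hk
      rw [zsmul_eq_mul]
      linear_combination hk / 2
    · apply hge
      · have := sub_mem hσ (zsmul_mem hpL j)
        convert this using 1
        conv_rhs => rw [hσeq]
        push_cast at hk
        rw [zsmul_eq_mul]
        linear_combination hk / 2
      · intro τ hτ
        obtain ⟨m, hm, -⟩ := (h.mem_iff τ).mp hτ
        refine ⟨m, hm.trans ?_⟩
        have : ((p : ℂ) / 2).im = 0 := by
          rw [show (p : ℂ) / 2 = ((p / 2 : ℝ) : ℂ) by push_cast; ring, ofReal_im]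
        simp [this]
  · left
    apply hge _ h.four_mem
    intro τ hτ
    obtain ⟨m, hm, -⟩ := (h.mem_iff τ).mp hτ
    rcases Int.even_or_odd' m with ⟨n, rfl | rfl⟩
    · refine ⟨n, hm.trans ?_⟩
      push_cast
      simp
      ring
    · exact absurd ⟨τ, hτ, n, hm⟩ hodd

/-- For a period `τ` with imaginary part `2Tm`, `2τ - 4Tmi` is the real period `2 Re τ`. Without
nonzero real periods all periods are thus imaginary, hence dependent. -/
theorem isEquivariantTorus_iff : IsEquivariantTorus f ↔ realPeriods f ≠ ⊥ := by
  constructor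
  · rintro ⟨w₁, h₁, w₂, h₂, hli⟩ hbot
    have hre : ∀ τ ∈ periodLattice f, τ.re = 0 := by
      intro τ hτ
      obtain ⟨m, hm, -⟩ := (h.mem_iff τ).mp hτ
      have hmem : ((2 * τ.re : ℝ) : ℂ) ∈ periodLattice f := by
        have := sub_mem (add_mem hτ hτ) (zsmul_mem h.four_mem m)
        convert this using 1
        apply Complex.ext
        · simp; ring
        · simp [hm]; ring
      have : (2 * τ.re : ℝ) ∈ realPeriods f := hmem
      rw [hbot, AddSubgroup.mem_bot] at this
      linarith
    rw [LinearIndependent.pair_iff] at hli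
    have e := hli w₂.im (-w₁.im) (by
      apply Complex.ext
      · simp [hre w₁ h₁, hre w₂ h₂]
      · simp; ring)
    have hw₁ : w₁ = 0 := Complex.ext (hre w₁ h₁) (by simpa using e.2)
    have := hli 1 0 (by simp [hw₁])
    exact one_ne_zero this.1
  · intro hne
    obtain ⟨p, hp, -⟩ := h.lattice_eq hne
    refine ⟨p, hp.1.2, _, h.four_mem, ?_⟩
    rw [LinearIndependent.pair_iff]
    intro s t hst
    have h1 := congrArg Complex.re hst
    have h2 := congrArg Complex.im hst
    simp at h1 h2
    exact ⟨h1.resolve_right hp.1.1.ne', h2.resolve_right h.halfPeriod_ne_zero⟩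

/-- The ratio of two eigenvalues is rational exactly when there is a nonzero real period. -/
theorem rational_iff {d₁ d₂ d₃ : ℂ} (hd : ({I * d₁, I * d₂, I * d₃} : Multiset ℂ) =
      {I * (δ 0 : ℂ), I * (δ 1 : ℂ), I * (δ 2 : ℂ)}) :
    d₂ ≠ 0 ∧ (realPeriods f ≠ ⊥ ↔ ∃ q : ℚ, d₁ / d₂ = (q : ℂ)) := by
  -- The `d`s match the `δ j` in an unknown order, so only statements about all three at once are
  -- transferred.
  have hall : ∀ P : ℂ → Prop, (P (I * d₁) ∧ P (I * d₂) ∧ P (I * d₃)) ↔ ∀ j, P (I * δ j) := by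
    intro P
    have h1 : (∀ u ∈ ({I * d₁, I * d₂, I * d₃} : Multiset ℂ), P u) ↔
        (∀ u ∈ ({I * (δ 0 : ℂ), I * (δ 1 : ℂ), I * (δ 2 : ℂ)} : Multiset ℂ), P u) := by rw [hd]
    simp only [Multiset.insert_eq_cons, Multiset.mem_cons, Multiset.mem_singleton,
      forall_eq_or_imp, forall_eq] at h1
    rw [h1, Fin.forall_fin_succ, Fin.forall_fin_two]
    rfl
  have hsum : d₁ + d₂ + d₃ = 0 := by
    have h1 := congrArg Multiset.sum hd
    simp only [Multiset.insert_eq_cons, Multiset.sum_cons, Multiset.sum_singleton] at h1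
    have h2 : (δ 0 : ℂ) + δ 1 + δ 2 = 0 := by exact_mod_cast congrArg ((↑) : ℝ → ℂ) h.e₁
    apply mul_left_cancel₀ I_ne_zero
    linear_combination h1 + I * h2
  have hd₂ : d₂ ≠ 0 := by
    have := ((hall (fun u => u ≠ 0)).mpr
      (fun j => mul_ne_zero I_ne_zero (ofReal_ne_zero.mpr (h.ne_zero j)))).2.1
    exact right_ne_zero_of_mul this
  obtain ⟨t, ht⟩ : ∃ t : ℝ, I * d₂ = I * t := by
    exact ((hall (fun u => ∃ t : ℝ, u = I * t)).mpr (fun j => ⟨δ j, rfl⟩)).2.1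
  have ht' : d₂ = t := mul_left_cancel₀ I_ne_zero ht
  have ht0 : t ≠ 0 := by rintro rfl; exact hd₂ (by simpa using ht')
  have hreal : ∀ x : ℝ, x ∈ realPeriods f ↔ ∃ c : ℂ, Complex.exp (I * d₁ * x) = c ∧
      Complex.exp (I * d₂ * x) = c ∧ Complex.exp (I * d₃ * x) = c := by
    intro x
    rw [mem_realPeriods, h.ofReal_mem_iff]
    exact exists_congr fun c => (hall (fun u => Complex.exp (u * x) = c)).symm
  refine ⟨hd₂, ?_, ?_⟩
  · intro hne
    obtain ⟨⟨x, hx⟩, hxne⟩ := AddSubgroup.ne_bot_iff_exists_ne_zero.mp hne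
    have hx0 : x ≠ 0 := fun h0 => hxne (Subtype.ext h0)
    obtain ⟨c, c1, c2, c3⟩ := (hreal x).mp hx
    obtain ⟨n, hn⟩ := Complex.exp_eq_exp_iff_exists_int.mp (c1.trans c2.symm)
    obtain ⟨l, hl⟩ := Complex.exp_eq_exp_iff_exists_int.mp (c1.trans c3.symm)
    have hx0' : (x : ℂ) ≠ 0 := ofReal_ne_zero.mpr hx0
    have hpi : (Real.pi : ℂ) ≠ 0 := ofReal_ne_zero.mpr Real.pi_ne_zero
    -- Only the differences `d₁ - d₂` and `d₁ - d₃` are known to be in `(2π/x)ℤ`; the zero sum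
    -- recovers each `d` up to the factor `3`.
    have k1 : 3 * ((x : ℂ) * d₁) = 2 * Real.pi * (n + l) := by
      apply mul_left_cancel₀ I_ne_zero
      linear_combination hn + hl + I * (x : ℂ) * hsum
    have k2 : 3 * ((x : ℂ) * d₂) = 2 * Real.pi * (l - 2 * n) := by
      apply mul_left_cancel₀ I_ne_zero
      linear_combination hl - 2 * hn + I * (x : ℂ) * hsum
    have hne' : ((l : ℂ) - 2 * n) ≠ 0 := by
      intro h0
      rw [h0, mul_zero] at k2
      exact (mul_ne_zero three_ne_zero (mul_ne_zero hx0' hd₂)) k2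
    refine ⟨((n + l : ℤ) : ℚ) / ((l - 2 * n : ℤ) : ℚ), ?_⟩
    push_cast
    rw [div_eq_div_iff hd₂ hne']
    have h6 : (2 * Real.pi : ℂ) ≠ 0 := mul_ne_zero two_ne_zero hpi
    apply mul_left_cancel₀ h6
    linear_combination d₂ * k1 - d₁ * k2
  · rintro ⟨q, hq⟩ hbot
    have hd₁ : d₁ = q * d₂ := by rw [← hq, div_mul_cancel₀ _ hd₂]
    have hqd : (q : ℂ) * q.den = q.num := by exact_mod_cast q.mul_den_eq_num
    have hden : (q.den : ℝ) ≠ 0 := by exact_mod_cast q.den_nz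
    have htc : (t : ℂ) ≠ 0 := ofReal_ne_zero.mpr ht0
    -- Clearing the denominator of `q` makes `d₁x` and `d₂x` multiples of `2π`, hence also `d₃x =
    -- -(d₁ + d₂)x`; the common phase is `1`.
    have hmem : 2 * Real.pi * q.den / t ∈ realPeriods f := by
      rw [hreal]
      refine ⟨1, ?_, ?_, ?_⟩
      · rw [Complex.exp_eq_one_iff]
        refine ⟨q.num, ?_⟩
        rw [hd₁, ht', ← hqd]; push_cast; field_simp
      · rw [Complex.exp_eq_one_iff]
        refine ⟨q.den, ?_⟩
        rw [ht']; push_cast; field_simp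
      · rw [Complex.exp_eq_one_iff]
        refine ⟨-(q.num + q.den), ?_⟩
        rw [show d₃ = -(q * d₂ + d₂) by linear_combination hsum - hd₁, ht']
        push_cast
        rw [← hqd]
        field_simp
    rw [hbot, AddSubgroup.mem_bot] at hmem
    exact (div_ne_zero (mul_ne_zero Real.two_pi_pos.ne' hden) ht0) hmem

end
end PeriodData

end

end MinLag

/-! ### Assembly of the theorem. -/

open MinLag Complex Polynomial in
theorem mainTheorem9
    (f : ℂ → CP2) (F : ℂ → C3)
    (hF : IsMinimalLagrangianLift F f)
    (hequiv : IsTranslationallyEquivariant f)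
    (hnonflat : ∃ z w, metricU F z ≠ metricU F w)
    (lam : ℂ) (hlam : ‖lam‖ = 1)
    (ψ : ℂ → ℂ) (hψ : ∀ z, hopf F z = -I * lam ^ (-3 : ℤ) * ψ z)
    (hψ_ne : ∃ z, ψ z ≠ 0)
    (hreal : ∀ z, (lam ^ (-3 : ℤ) * ψ z).im = 0)
    (d₁ d₂ d₃ : ℂ)
    (hd : (generator F lam).charpoly = (X - C (I * d₁)) * (X - C (I * d₂)) * (X - C (I * d₃))) :
    (IsEquivariantTorus f →
      (∃ p : ℝ, IsLeast {t : ℝ | 0 < t ∧ (t : ℂ) ∈ periodLattice f} p ∧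
        (periodLattice f = AddSubgroup.zmultiples (p : ℂ) ⊔
            AddSubgroup.zmultiples (4 * (halfPeriod F : ℂ) * I) ∨
          periodLattice f = AddSubgroup.zmultiples (p : ℂ) ⊔
            AddSubgroup.zmultiples ((p : ℂ) / 2 + 2 * (halfPeriod F : ℂ) * I))) ∧
      d₂ ≠ 0 ∧ ∃ q : ℚ, d₁ / d₂ = (q : ℂ)) ∧
    ((∃ q : ℚ, d₁ / d₂ = (q : ℂ)) →
      IsEquivariantTorus f ∧
      ∃ p : ℝ, IsLeast {t : ℝ | 0 < t ∧ (t : ℂ) ∈ periodLattice f} p ∧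
        (periodLattice f = AddSubgroup.zmultiples (p : ℂ) ⊔
            AddSubgroup.zmultiples (4 * (halfPeriod F : ℂ) * I) ∨
          periodLattice f = AddSubgroup.zmultiples (p : ℂ) ⊔
            AddSubgroup.zmultiples ((p : ℂ) / 2 + 2 * (halfPeriod F : ℂ) * I))) := by
  have hr : ∀ z, hopf F z = -I * (((lam ^ (-3 : ℤ) * ψ z).re : ℝ) : ℂ) := by
    intro z
    rw [hψ, mul_assoc]
    congr 1
    exact Complex.ext rfl (hreal z)
  obtain ⟨hconst, hV, hS, hv, β, hβ, hv₁⟩ := hF.structureEquations hequiv hr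
  set ρ := (lam ^ (-3 : ℤ) * ψ 0).re with hρdef
  have hρ : ρ ≠ 0 := by
    obtain ⟨z, hz⟩ := hψ_ne
    rw [← hconst z]
    intro h0
    have hl : lam ≠ 0 := by rintro rfl; simp at hlam
    have : lam ^ (-3 : ℤ) * ψ z = 0 := Complex.ext h0 (hreal z)
    exact mul_ne_zero (zpow_ne_zero _ hl) hz this
  obtain ⟨δ, hδ⟩ := hF.exists_periodData hρ (hr 0) hV hS hv hβ hv₁ (by
    obtain ⟨z, w, hzw⟩ := hnonflat
    exact ⟨z, w, fun h => hzw (by rw [metricU, metricU, h])⟩)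
  have hβ0 := hβ 0
  rw [ofReal_zero, zero_mul] at hβ0
  have hchar := hF.charpoly_generator hequiv hr hβ0 hlam
  -- Both products equal `X³ + βX - 2iρ`; comparing roots identifies the eigenvalues as a multiset.
  have hfac : (X - C (I * d₁)) * (X - C (I * d₂)) * (X - C (I * d₃)) =
      (X - C (I * (δ 0 : ℂ))) * (X - C (I * (δ 1 : ℂ))) * (X - C (I * (δ 2 : ℂ))) := by
    rw [← hd, hchar]
    have e1 : (δ 0 : ℂ) + δ 1 + δ 2 = 0 := by exact_mod_cast congrArg ((↑) : ℝ → ℂ) hδ.e₁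
    have e2 : (δ 0 : ℂ) * δ 1 + δ 0 * δ 2 + δ 1 * δ 2 = -β := by
      exact_mod_cast congrArg ((↑) : ℝ → ℂ) hδ.e₂
    have e3 : (δ 0 : ℂ) * δ 1 * δ 2 = -(2 * ρ) := by
      exact_mod_cast congrArg ((↑) : ℝ → ℂ) hδ.e₃
    have c1 : C (I * (δ 0 : ℂ)) + C (I * (δ 1 : ℂ)) + C (I * (δ 2 : ℂ)) = 0 := by
      rw [← C_add, ← C_add, ← C_0]; congr 1; linear_combination I * e1
    have c2 : C (I * (δ 0 : ℂ)) * C (I * (δ 1 : ℂ)) + C (I * (δ 0 : ℂ)) * C (I * (δ 2 : ℂ)) +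
        C (I * (δ 1 : ℂ)) * C (I * (δ 2 : ℂ)) = C (β : ℂ) := by
      simp only [← C_add, ← C_mul]; congr 1
      linear_combination (I * I) * e2 - β * I_mul_I
    have c3 : C (I * (δ 0 : ℂ)) * C (I * (δ 1 : ℂ)) * C (I * (δ 2 : ℂ)) = C (2 * I * ρ) := by
      simp only [← C_mul]; congr 1
      linear_combination (I * I * I) * e3 - 2 * I * ρ * I_mul_I
    linear_combination X ^ 2 * c1 - X * c2 + c3
  have hroots : ({I * d₁, I * d₂, I * d₃} : Multiset ℂ) =
      {I * (δ 0 : ℂ), I * (δ 1 : ℂ), I * (δ 2 : ℂ)} := by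
    have key : ∀ a b c : ℂ, ((X - C a) * (X - C b) * (X - C c)).roots = {a, b, c} := by
      intro a b c
      have := Polynomial.roots_multiset_prod_X_sub_C ({a, b, c} : Multiset ℂ)
      simpa [mul_assoc] using this
    rw [← key, ← key, hfac]
  obtain ⟨hd₂, hrat⟩ := hδ.rational_iff hroots
  refine ⟨fun ht => ?_, fun hq => ?_⟩
  · have hne := hδ.isEquivariantTorus_iff.mp ht
    exact ⟨hδ.lattice_eq hne, hd₂, hrat.mp hne⟩
  · have hne := hrat.mpr hq
    exact ⟨hδ.isEquivariantTorus_iff.mpr hne, hδ.lattice_eq hne⟩
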